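/- Let $F$ be an algebraically closed field of characteristic $0$, and let $A \in M_n(F)$ have trace zero. The invariant polynomials of $A$ are the monic polynomials $f_1 \mid f_2 \mid \cdots \mid f_n$ on the diagonal of the Smith canonical form of $xI - A$ over $F[x]$. Let $m$ be the number of indices $i$ with $\deg f_i = 2$, and let $\mathrm{n}(B)$ denote the dimension of the null space of a matrix $B$. A matrix $S \in M_n(F)$ is square-zero if $S^2 = 0$. Then each of the following conditions implies that $A$ is a sum of three square-zero matrices: 1. $\mathrm{n}(A - \lambda I) \le (2n - m)/3$ for all $\lambda \in F$; 2. $\mathrm{n}(A - \lambda I) \le n/2$ for all $\lambda \in F$; 3. $\mathrm{n}(A - \lambda I) \le n/2 + 1$ for all $\lambda \in F$. -/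

import Mathlib

/-- `f 0, …, f (n-1)` is the list of invariant polynomials of `A`: the diagonal of the Smith
canonical form of the characteristic matrix `x I - A`. That is, all `f i` are monic, each divides
the next, and `x I - A` is equivalent over `F[x]` to the diagonal matrix with entries `f i`. -/
def IsInvariantPolynomials {F : Type*} [Field F] {n : ℕ} (A : Matrix (Fin n) (Fin n) F)
    (f : Fin n → Polynomial F) : Prop :=
  (∀ i, (f i).Monic) ∧
  (∀ i j, i ≤ j → f i ∣ f j) ∧
  ∃ U V : Matrix (Fin n) (Fin n) (Polynomial F), IsUnit U ∧ IsUnit V ∧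
    U * A.charmatrix * V = Matrix.diagonal f

/-- The number of polynomials of degree two in the list `f`. -/
def numDegreeTwo {F : Type*} [Field F] {n : ℕ} (f : Fin n → Polynomial F) : ℕ :=
  (Finset.univ.filter fun i => (f i).natDegree = 2).card

/-- The nullity of a square matrix: the dimension of its null space. -/
noncomputable def nullity {F : Type*} [Field F] {n : ℕ} (A : Matrix (Fin n) (Fin n) F) : ℕ :=
  Module.finrank F (LinearMap.ker (Matrix.toLin' A))

/-- `A` is a sum of three square-zero matrices. -/
def IsSumOfThreeSquareZero {F : Type*} [Field F] {n : ℕ} (A : Matrix (Fin n) (Fin n) F) : Prop :=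
  ∃ S₁ S₂ S₃ : Matrix (Fin n) (Fin n) F,
    S₁ ^ 2 = 0 ∧ S₂ ^ 2 = 0 ∧ S₃ ^ 2 = 0 ∧ A = S₁ + S₂ + S₃

/-!
An endomorphism `f` that anticommutes with an involution is called odd. For the grading
`V = V₀ ⊕ V₁` by the eigenspaces of the involution it consists of a part `V₀ → V₁` and a part
`V₁ → V₀`, and each of these squares to zero (`OddEnd.exists_add`). So it suffices to make the given
endomorphism odd by subtracting one square-zero endomorphism (`OddModSquareZero`). Odd endomorphisms
are plentiful: `X ⊕ (-X)` and all nilpotent endomorphisms are odd, and direct sums of odd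
endomorphisms are odd.

The endomorphism is decomposed into cyclic summands with polynomials `p ∈ L`, where any two members
of `L` have a common root and all members of degree two are equal (`ReducedList`). For the first
bound `L` consists of the nonconstant invariant polynomials; for the others an arbitrary cyclic
decomposition with maximal sum of squares of the degrees will do (`exists_reducedList`).

A summand `B` is called linkable (`Linkable`) if for almost every scalar `y` it becomes
`y ⊕ (-z) ⊕ odd` after subtraction of a square-zero endomorphism; then `z = y - tr B`. In a direct
sum of linkable endomorphisms the end `-z` of one summand cancels the end `z` of the next one, and
if the total trace is zero then the first and the last end cancel as well. Cyclic summands of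
dimension at least two are linkable: changing the last column of a companion matrix replaces its
polynomial by `(X - y) (X + z) X ^ (n - 2)` (`linkable_mulRoot`).

There remain the one-dimensional summands. They all carry the same scalar `c`, which is a root of
every member of `L`. If `c = 0` they are odd. If `c ≠ 0`, a cyclic summand of dimension `d ≥ 3` can
absorb up to `2 d - 3` of them and still be linkable (`linkable_mulRoot_prod`). The reason is that a
cyclic summand together with copies of `c` is a block triangular endomorphism `[[c, 0], [R, g]]`.
Conjugation by a unipotent matrix and subtraction of a square-zero block change its diagonal blocks
into `c + X R` and `g - R X` with arbitrary `X` (`exists_sub_sim_lowerBlock`), and in a Hessenberg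
basis of `F[X] / (g)` the freedom in `X` suffices to prescribe the eigenvalues
(`exists_sub_sim_lowerBlock_of_trace`).

Counting dimensions, either bound on the nullity of `A - c` leaves at most as many one-dimensional
summands as can be absorbed, with one exception: all other summands have the same polynomial
`(X - c) (X - μ)` and there are one or two one-dimensional summands. In that case a chain with a
single end is used (`HasEnd`), whose end `Y` is an endomorphism of a space of dimension one or two
and moves by `c + μ` in each step. By the vanishing of the trace it moves either from `c` to `0`, or
from `(c + μ) / 2` to `-c` up to a nilpotent term (`HasCyclicType.oddModSquareZero_smul_one_prod`).
-/

namespace SquareZeroSum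

open Polynomial

universe u

/-! ### Similarity and odd endomorphisms -/

section Basic

variable {F : Type u} [Field F]
variable {V W V' W' U : Type u} [AddCommGroup V] [Module F V] [AddCommGroup W] [Module F W]
  [AddCommGroup V'] [Module F V'] [AddCommGroup W'] [Module F W'] [AddCommGroup U] [Module F U]

/-- Similarity of endomorphisms of possibly different vector spaces: some linear equivalence
intertwines them. -/
def Sim (f : Module.End F V) (g : Module.End F W) : Prop :=
  ∃ e : V ≃ₗ[F] W, ∀ v, e (f v) = g (e v)

theorem Sim.refl (f : Module.End F V) : Sim f f := ⟨LinearEquiv.refl F V, fun _ => rfl⟩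

theorem Sim.symm {f : Module.End F V} {g : Module.End F W} (h : Sim f g) : Sim g f := by
  obtain ⟨e, he⟩ := h
  exact ⟨e.symm, fun w => by rw [LinearEquiv.symm_apply_eq, he, e.apply_symm_apply]⟩

theorem Sim.trans {f : Module.End F V} {g : Module.End F W} {h : Module.End F U}
    (h₁ : Sim f g) (h₂ : Sim g h) : Sim f h := by
  obtain ⟨e, he⟩ := h₁
  obtain ⟨e', he'⟩ := h₂
  exact ⟨e.trans e', fun v => by simp [he, he']⟩

theorem Sim.prod {f : Module.End F V} {g : Module.End F W} {f' : Module.End F V'}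
    {g' : Module.End F W'} (h : Sim f f') (h' : Sim g g') :
    Sim (f.prodMap g) (f'.prodMap g') := by
  obtain ⟨e, he⟩ := h
  obtain ⟨e', he'⟩ := h'
  exact ⟨LinearEquiv.prodCongr e e', fun v => by simp [he, he']⟩

theorem Sim.prodComm (f : Module.End F V) (g : Module.End F W) :
    Sim (f.prodMap g) (g.prodMap f) :=
  ⟨LinearEquiv.prodComm F V W, fun v => by simp⟩

theorem Sim.prodAssoc (f : Module.End F V) (g : Module.End F W) (h : Module.End F U) :
    Sim ((f.prodMap g).prodMap h) (f.prodMap (g.prodMap h)) :=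
  ⟨LinearEquiv.prodAssoc F V W U, fun v => by simp⟩

theorem Sim.prodLeftComm (f : Module.End F V) (g : Module.End F W) (h : Module.End F U) :
    Sim (f.prodMap (g.prodMap h)) (g.prodMap (f.prodMap h)) :=
  (Sim.prodAssoc f g h).symm.trans
    (((Sim.prodComm f g).prod (Sim.refl h)).trans (Sim.prodAssoc g f h))

theorem Sim.prodProdProdComm (f : Module.End F V) (g : Module.End F W) (f' : Module.End F V')
    (g' : Module.End F W') :
    Sim ((f.prodMap g).prodMap (f'.prodMap g')) ((f.prodMap f').prodMap (g.prodMap g')) :=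
  ⟨LinearEquiv.prodProdProdComm F V W V' W', fun v => by simp⟩

theorem Sim.prod_subsingleton (f : Module.End F V) (g : Module.End F W) [Subsingleton W] :
    Sim (f.prodMap g) f :=
  ⟨{ LinearMap.fst F V W with
      invFun := fun w => (w, 0)
      left_inv := fun _ => Prod.ext rfl (Subsingleton.elim _ _)
      right_inv := fun _ => rfl }, fun _ => rfl⟩

theorem Sim.of_subsingleton (f : Module.End F V) (g : Module.End F W) [Subsingleton V]
    [Subsingleton W] : Sim f g :=
  ⟨0, fun _ => Subsingleton.elim _ _⟩

theorem Sim.conj {f : Module.End F V} (e : V ≃ₗ[F] W) : Sim f (e.conj f) :=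
  ⟨e, fun v => by simp [LinearEquiv.conj_apply]⟩

theorem Sim.exists_conj {f : Module.End F V} {g : Module.End F W} (h : Sim f g) :
    ∃ e : V ≃ₗ[F] W, e.conj f = g := by
  obtain ⟨e, he⟩ := h
  exact ⟨e, by ext w; simp [LinearEquiv.conj_apply, he]⟩

theorem Sim.trace_eq {f : Module.End F V} {g : Module.End F W} (h : Sim f g) :
    LinearMap.trace F V f = LinearMap.trace F W g := by
  obtain ⟨e, rfl⟩ := h.exists_conj
  exact (LinearMap.trace_conj' f e).symm

/-- Scalar endomorphisms of spaces of the same dimension are similar. -/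
theorem Sim.smul_one [FiniteDimensional F V] [FiniteDimensional F W] (c : F)
    (h : Module.finrank F V = Module.finrank F W) :
    Sim (c • (1 : Module.End F V)) (c • (1 : Module.End F W)) :=
  ⟨LinearEquiv.ofFinrankEq V W h, fun v => by simp⟩

theorem smul_one_prodMap (c : F) :
    (c • (1 : Module.End F V)).prodMap (c • (1 : Module.End F W)) =
      c • (1 : Module.End F (V × W)) := by
  ext <;> simp

theorem conj_mul' (e : V ≃ₗ[F] W) (f g : Module.End F V) :
    e.conj (f * g) = e.conj f * e.conj g :=
  LinearEquiv.conj_comp e g f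

/-- An endomorphism that anticommutes with an involution, that is, one that is odd for some
`ℤ/2`-grading of the space. -/
def OddEnd (f : Module.End F V) : Prop :=
  ∃ J : Module.End F V, J * J = 1 ∧ J * f = -(f * J)

theorem OddEnd.of_sim {f : Module.End F V} {g : Module.End F W} (h : Sim f g) (hg : OddEnd g) :
    OddEnd f := by
  obtain ⟨e, he⟩ := h.symm.exists_conj
  obtain ⟨J, hJ, hJg⟩ := hg
  refine ⟨e.conj J, ?_, ?_⟩
  · rw [← conj_mul', hJ]; exact LinearEquiv.conj_id e
  · rw [← he, ← conj_mul', hJg, map_neg, conj_mul']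

theorem OddEnd.prod {f : Module.End F V} {g : Module.End F W} (hf : OddEnd f) (hg : OddEnd g) :
    OddEnd (f.prodMap g) := by
  obtain ⟨J, hJ, hJf⟩ := hf
  obtain ⟨J', hJ', hJg⟩ := hg
  refine ⟨J.prodMap J', ?_, ?_⟩
  · rw [LinearMap.prodMap_mul, hJ, hJ', LinearMap.prodMap_one]
  · rw [LinearMap.prodMap_mul, LinearMap.prodMap_mul, hJf, hJg]
    ext <;> simp

/-- The swap of the two summands anticommutes with `X × (-X)`. -/
theorem OddEnd.prod_neg (X : Module.End F V) : OddEnd (X.prodMap (-X)) := by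
  refine ⟨(LinearEquiv.prodComm F V V).toLinearMap, ?_, ?_⟩
  · ext <;> simp
  · ext <;> simp

theorem OddEnd.neg_prod (X : Module.End F V) : OddEnd ((-X).prodMap X) :=
  (OddEnd.prod_neg X).of_sim (Sim.prodComm _ _)

theorem OddEnd.zero : OddEnd (0 : Module.End F V) := ⟨1, by simp, by simp⟩

theorem OddEnd.of_subsingleton [Subsingleton V] (f : Module.End F V) : OddEnd f :=
  ⟨1, by simp, LinearMap.ext fun _ => Subsingleton.elim _ _⟩

/-- The endomorphism becomes odd after subtraction of a square-zero endomorphism. In characteristic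
other than two it is then a sum of three square-zero endomorphisms. -/
def OddModSquareZero (f : Module.End F V) : Prop :=
  ∃ S : Module.End F V, S * S = 0 ∧ OddEnd (f - S)

theorem OddModSquareZero.of_sim {f : Module.End F V} {g : Module.End F W} (h : Sim f g)
    (hg : OddModSquareZero g) : OddModSquareZero f := by
  obtain ⟨e, he⟩ := h.symm.exists_conj
  obtain ⟨S, hS, hgS⟩ := hg
  refine ⟨e.conj S, ?_, ?_⟩
  · rw [← conj_mul', hS, map_zero]
  · rw [← he, ← map_sub]
    exact hgS.of_sim (Sim.conj e).symm

theorem OddModSquareZero.prod {f : Module.End F V} {g : Module.End F W}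
    (hf : OddModSquareZero f) (hg : OddModSquareZero g) : OddModSquareZero (f.prodMap g) := by
  obtain ⟨S, hS, hf⟩ := hf
  obtain ⟨T, hT, hg⟩ := hg
  refine ⟨S.prodMap T, ?_, ?_⟩
  · rw [LinearMap.prodMap_mul, hS, hT]; ext <;> simp
  · have : f.prodMap g - S.prodMap T = (f - S).prodMap (g - T) := by ext <;> simp
    rw [this]
    exact hf.prod hg

/-- An odd endomorphism is the sum of its parts `V₀ → V₁` and `V₁ → V₀` for the grading
`V = V₀ ⊕ V₁`, and both parts square to zero. -/
theorem OddEnd.exists_add [NeZero (2 : F)] {f : Module.End F V} (hf : OddEnd f) :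
    ∃ S T : Module.End F V, S * S = 0 ∧ T * T = 0 ∧ f = S + T := by
  obtain ⟨J, hJ, hJf⟩ := hf
  have h2 : (2 : F) ≠ 0 := NeZero.ne 2
  have key : ∀ v, J (f v) = -f (J v) := fun v => by
    simpa using LinearMap.congr_fun hJf v
  have keyJ : ∀ v, J (J v) = v := fun v => by simpa using LinearMap.congr_fun hJ v
  refine ⟨(2⁻¹ : F) • (f * (1 + J)), (2⁻¹ : F) • (f * (1 - J)), ?_, ?_, ?_⟩
  · ext v; simp [key, keyJ]
  · ext v
    simp only [LinearMap.smul_apply, Module.End.mul_apply, LinearMap.sub_apply,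
      Module.End.one_apply, map_smul, map_sub, map_neg, key, keyJ, LinearMap.zero_apply]
    module
  · ext v
    simp only [LinearMap.add_apply, LinearMap.smul_apply, Module.End.mul_apply,
      Module.End.one_apply, LinearMap.sub_apply, map_add, map_sub]
    rw [← smul_add]
    have : f v + f (J v) + (f v - f (J v)) = (2 : F) • f v := by rw [two_smul]; abel
    rw [this, smul_smul, inv_mul_cancel₀ h2, one_smul]

/-- The passage from endomorphisms back to matrices. -/
theorem isSumOfThreeSquareZero_of_toLin' [NeZero (2 : F)] {n : ℕ} {A : Matrix (Fin n) (Fin n) F}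
    (h : OddModSquareZero (Matrix.toLin' A)) : IsSumOfThreeSquareZero A := by
  obtain ⟨S, hS, h⟩ := h
  obtain ⟨T, T', hT, hT', h⟩ := h.exists_add
  have key : ∀ X : Module.End F (Fin n → F), X * X = 0 → (LinearMap.toMatrix' X) ^ 2 = 0 := by
    intro X hX
    rw [sq, ← LinearMap.toMatrix'_mul, hX, map_zero]
  refine ⟨_, _, _, key S hS, key T hT, key T' hT', ?_⟩
  have : Matrix.toLin' A = S + T + T' := by rw [add_assoc, ← h]; abel
  rw [← map_add, ← map_add, ← this, LinearMap.toMatrix'_toLin']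

end Basic

/-! ### Cyclic endomorphisms and direct sums of them -/

section Cyclic

variable {F : Type u} [Field F]
variable {V W U : Type u} [AddCommGroup V] [Module F V] [AddCommGroup W] [Module F W]
  [AddCommGroup U] [Module F U]

/-- Multiplication by the class of `X` on `F[X] / (p)`: the coordinate-free companion matrix
of `p`. -/
noncomputable def mulRoot (p : F[X]) : Module.End F (AdjoinRoot p) :=
  LinearMap.mulLeft F (AdjoinRoot.root p)

theorem mulRoot_apply (p : F[X]) (v : AdjoinRoot p) : mulRoot p v = AdjoinRoot.root p * v := rfl

theorem mulRoot_mk (p q : F[X]) : mulRoot p (AdjoinRoot.mk p q) = AdjoinRoot.mk p (X * q) := by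
  rw [mulRoot_apply, map_mul, AdjoinRoot.mk_X]

theorem mulRoot_pow_apply (p : F[X]) (n : ℕ) (v : AdjoinRoot p) :
    (mulRoot p ^ n) v = AdjoinRoot.root p ^ n * v := by
  rw [mulRoot, LinearMap.pow_mulLeft]; rfl

theorem finrank_adjoinRoot (p : F[X]) :
    Module.finrank F (AdjoinRoot p) = p.natDegree :=
  finrank_quotient_span_eq_natDegree

theorem finiteDimensional_adjoinRoot {p : F[X]} (hp : p.Monic) :
    FiniteDimensional F (AdjoinRoot p) := hp.finite_adjoinRoot

/-- On a one-dimensional cyclic module the root acts as a scalar. -/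
theorem sim_mulRoot_X_sub_C (c : F) :
    Sim (mulRoot (X - C c)) (c • (1 : Module.End F F)) := by
  have := finiteDimensional_adjoinRoot (monic_X_sub_C c)
  have h : mulRoot (X - C c) = c • 1 := by
    ext v
    obtain ⟨q, rfl⟩ := AdjoinRoot.mk_surjective v
    rw [mulRoot_mk, LinearMap.smul_apply, Module.End.one_apply, AdjoinRoot.smul_mk,
      AdjoinRoot.mk_eq_mk, smul_eq_C_mul, ← sub_mul]
    exact dvd_mul_right _ _
  rw [h]
  exact Sim.smul_one c (by rw [finrank_adjoinRoot]; simp)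

theorem mk_mul_ker_iff {p q : F[X]} (h : IsCoprime p q) (a : F[X]) :
    AdjoinRoot.mk (p * q) a = 0 ↔ AdjoinRoot.mk p a = 0 ∧ AdjoinRoot.mk q a = 0 := by
  simp only [AdjoinRoot.mk_eq_zero]
  exact ⟨fun H => ⟨dvd_of_mul_right_dvd H, dvd_of_mul_left_dvd H⟩, fun H => h.mul_dvd H.1 H.2⟩

/-- Two quotients of a space by the same subspace are isomorphic, compatibly with the endomorphisms
`f` and `g` that one endomorphism `x` of the space induces on them. -/
theorem sim_of_surjective {x : Module.End F U} {f : Module.End F V} {g : Module.End F W}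
    (φ : U →ₗ[F] V) (ψ : U →ₗ[F] W) (hφ : Function.Surjective φ) (hψ : Function.Surjective ψ)
    (hker : ∀ u, φ u = 0 ↔ ψ u = 0) (hf : ∀ u, φ (x u) = f (φ u)) (hg : ∀ u, ψ (x u) = g (ψ u)) :
    Sim f g := by
  have hk : LinearMap.ker φ = LinearMap.ker ψ := by
    ext u; simp [hker]
  refine ⟨(φ.quotKerEquivOfSurjective hφ).symm.trans ((Submodule.quotEquivOfEq _ _ hk).trans
    (ψ.quotKerEquivOfSurjective hψ)), fun v => ?_⟩
  obtain ⟨u, rfl⟩ := hφ v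
  have key : ∀ u, (φ.quotKerEquivOfSurjective hφ).symm (φ u) = Submodule.Quotient.mk u := by
    intro u
    rw [LinearEquiv.symm_apply_eq]
    rfl
  rw [← hf]
  simp only [LinearEquiv.trans_apply, key, Submodule.quotEquivOfEq_mk]
  exact hg u

/-- The Chinese remainder theorem for companion endomorphisms. -/
theorem sim_mulRoot_mul {p q : F[X]} (h : IsCoprime p q) :
    Sim (mulRoot (p * q)) ((mulRoot p).prodMap (mulRoot q)) := by
  refine sim_of_surjective (x := LinearMap.mulLeft F (X : F[X]))
    (AdjoinRoot.mkₐ (p * q)).toLinearMap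
    ((AdjoinRoot.mkₐ p).toLinearMap.prod (AdjoinRoot.mkₐ q).toLinearMap)
    AdjoinRoot.mk_surjective ?_ ?_ ?_ ?_
  · rintro ⟨v, w⟩
    obtain ⟨a, rfl⟩ := AdjoinRoot.mk_surjective v
    obtain ⟨b, rfl⟩ := AdjoinRoot.mk_surjective w
    obtain ⟨r, s, hrs⟩ := h
    refine ⟨a * (s * q) + b * (r * p), Prod.ext ?_ ?_⟩
    · change AdjoinRoot.mk p _ = AdjoinRoot.mk p a
      rw [AdjoinRoot.mk_eq_mk]
      exact ⟨(b - a) * r, by linear_combination a * hrs⟩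
    · change AdjoinRoot.mk q _ = AdjoinRoot.mk q b
      rw [AdjoinRoot.mk_eq_mk]
      exact ⟨(a - b) * s, by linear_combination b * hrs⟩
  · intro a
    change AdjoinRoot.mk (p * q) a = 0 ↔ (AdjoinRoot.mk p a, AdjoinRoot.mk q a) = 0
    rw [mk_mul_ker_iff h, Prod.mk_eq_zero]
  · intro a
    exact (mulRoot_mk _ _).symm
  · intro a
    exact Prod.ext (mulRoot_mk _ _).symm (mulRoot_mk _ _).symm

/-- `HasCyclicType L f`: the endomorphism `f` is similar to the direct sum of the companion
endomorphisms `mulRoot p`, `p ∈ L`. -/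
def HasCyclicType : List F[X] → ∀ {V : Type u} [AddCommGroup V] [Module F V],
    Module.End F V → Prop
  | [], V, _, _, _ => Subsingleton V
  | p :: L, _, _, _, f => ∃ (W : Type u) (_ : AddCommGroup W) (_ : Module F W)
      (g : Module.End F W), HasCyclicType L g ∧ Sim f ((mulRoot p).prodMap g)

theorem HasCyclicType.of_sim {L : List F[X]} {f : Module.End F V} {g : Module.End F W}
    (h : Sim f g) (hg : HasCyclicType L g) : HasCyclicType L f := by
  cases L with
  | nil =>
    obtain ⟨e, -⟩ := h
    have : Subsingleton W := hg
    exact e.toEquiv.subsingleton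
  | cons p L =>
    obtain ⟨W', _, _, g', hg', hs⟩ := hg
    exact ⟨W', _, _, g', hg', h.trans hs⟩

theorem HasCyclicType.cons {L : List F[X]} {g : Module.End F W} (p : F[X])
    (hg : HasCyclicType L g) : HasCyclicType (p :: L) ((mulRoot p).prodMap g) :=
  ⟨W, _, _, g, hg, Sim.refl _⟩

theorem HasCyclicType.perm {L L' : List F[X]} (hL : L.Perm L') :
    ∀ {V : Type u} [AddCommGroup V] [Module F V] {f : Module.End F V},
      HasCyclicType L f → HasCyclicType L' f := by
  induction hL with
  | nil => exact fun h => h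
  | cons p _ ih =>
    rintro V _ _ f ⟨W, _, _, g, hg, hs⟩
    exact ⟨W, _, _, g, ih hg, hs⟩
  | swap p q L =>
    rintro V _ _ f ⟨W, _, _, g, ⟨W', _, _, g', hg', hs'⟩, hs⟩
    exact ⟨_, _, _, _, hg'.cons q,
      hs.trans (((Sim.refl _).prod hs').trans (Sim.prodLeftComm _ _ _))⟩
  | trans _ _ ih ih' => exact fun h => ih' (ih h)

theorem HasCyclicType.append {L L' : List F[X]} :
    ∀ {V : Type u} [AddCommGroup V] [Module F V] {f : Module.End F V},
      HasCyclicType (L ++ L') f → ∃ (W : Type u) (_ : AddCommGroup W) (_ : Module F W)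
        (g : Module.End F W) (W' : Type u) (_ : AddCommGroup W') (_ : Module F W')
        (g' : Module.End F W'), HasCyclicType L g ∧ HasCyclicType L' g' ∧
          Sim f (g.prodMap g') := by
  induction L with
  | nil =>
    intro V _ _ f h
    exact ⟨PUnit.{u+1}, inferInstance, inferInstance, 0, V, _, _, f,
      inferInstanceAs (Subsingleton PUnit.{u+1}),
      h, ((Sim.prod_subsingleton f (0 : Module.End F PUnit.{u+1})).symm).trans (Sim.prodComm _ _)⟩
  | cons p L ih =>
    rintro V _ _ f ⟨W₀, _, _, g₀, hg₀, hs₀⟩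
    obtain ⟨W, _, _, g, W', _, _, g', hg, hg', hs⟩ := ih hg₀
    exact ⟨_, _, _, _, W', _, _, g', hg.cons p, hg',
      hs₀.trans (((Sim.refl _).prod hs).trans (Sim.prodAssoc _ _ _).symm)⟩

theorem HasCyclicType.merge {L : List F[X]} {p q : F[X]} {f : Module.End F V}
    (h : HasCyclicType (p :: q :: L) f) (hpq : IsCoprime p q) :
    HasCyclicType ((p * q) :: L) f := by
  obtain ⟨W, _, _, g, ⟨W', _, _, g', hg', hs'⟩, hs⟩ := h
  exact ⟨_, _, _, _, hg', hs.trans (((Sim.refl _).prod hs').trans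
    ((Sim.prodAssoc _ _ _).symm.trans ((sim_mulRoot_mul hpq).symm.prod (Sim.refl _))))⟩

theorem HasCyclicType.split {L : List F[X]} {p q : F[X]} {f : Module.End F V}
    (h : HasCyclicType ((p * q) :: L) f) (hpq : IsCoprime p q) :
    HasCyclicType (p :: q :: L) f := by
  obtain ⟨W, _, _, g, hg, hs⟩ := h
  exact ⟨_, _, _, _, hg.cons q,
    hs.trans (((sim_mulRoot_mul hpq).prod (Sim.refl _)).trans (Sim.prodAssoc _ _ _))⟩

theorem HasCyclicType.finiteDimensional {L : List F[X]} :
    ∀ {V : Type u} [AddCommGroup V] [Module F V] {f : Module.End F V},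
      HasCyclicType L f → (∀ p ∈ L, p.Monic) → FiniteDimensional F V ∧
        Module.finrank F V = (L.map natDegree).sum := by
  induction L with
  | nil =>
    intro V _ _ f h _
    have : Subsingleton V := h
    exact ⟨inferInstance, by simp [Module.finrank_zero_of_subsingleton]⟩
  | cons p L ih =>
    rintro V _ _ f ⟨W, _, _, g, hg, ⟨e, -⟩⟩ hL
    rw [List.forall_mem_cons] at hL
    have := finiteDimensional_adjoinRoot hL.1
    obtain ⟨_, hW⟩ := ih hg hL.2
    refine ⟨e.symm.finiteDimensional, ?_⟩
    rw [e.finrank_eq, Module.finrank_prod, hW, finrank_adjoinRoot]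
    simp

/-- A factor of degree zero contributes the zero space. -/
theorem HasCyclicType.of_cons_one {L : List F[X]} {f : Module.End F V}
    (h : HasCyclicType (1 :: L) f) : HasCyclicType L f := by
  obtain ⟨W, _, _, g, hg, hs⟩ := h
  have : Subsingleton (AdjoinRoot (1 : F[X])) := by
    have := finiteDimensional_adjoinRoot (monic_one (R := F))
    exact Module.finrank_zero_iff.1 (by rw [finrank_adjoinRoot]; simp)
  exact HasCyclicType.of_sim
    (hs.trans ((Sim.prodComm _ _).trans (Sim.prod_subsingleton _ _))) hg

/-- A module of the form `∏ i, F[X] / (p i)` with `X` acting diagonally has the evident cyclic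
type. -/
theorem hasCyclicType_pi : ∀ {n : ℕ} (p : Fin n → F[X]),
    HasCyclicType (List.ofFn p)
      (LinearMap.pi fun i => mulRoot (p i) ∘ₗ LinearMap.proj i :
        Module.End F (∀ i, AdjoinRoot (p i)))
  | 0, p => by
    rw [List.ofFn_zero]
    exact inferInstanceAs (Subsingleton (∀ i : Fin 0, AdjoinRoot (p i)))
  | n + 1, p => by
    rw [List.ofFn_succ]
    refine ⟨_, _, _, _, hasCyclicType_pi (fun i : Fin n => p i.succ),
      (Fin.consLinearEquiv F (fun i => AdjoinRoot (p i))).symm, fun v => ?_⟩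
    rw [LinearEquiv.symm_apply_eq]
    funext i
    refine Fin.cases ?_ (fun j => ?_) i <;> rfl

end Cyclic

/-! ### Existence of cyclic decompositions, and nilpotent endomorphisms -/

section Structure

variable {F : Type u} [Field F]
variable {V W U : Type u} [AddCommGroup V] [Module F V] [AddCommGroup W] [Module F W]
  [AddCommGroup U] [Module F U]

theorem sim_mulRoot_of_associated {p q : F[X]} (h : Associated p q) :
    Sim (mulRoot p) (mulRoot q) := by
  refine sim_of_surjective (x := LinearMap.mulLeft F (X : F[X]))
    (AdjoinRoot.mkₐ p).toLinearMap (AdjoinRoot.mkₐ q).toLinearMap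
    AdjoinRoot.mk_surjective AdjoinRoot.mk_surjective (fun a => ?_)
    (fun a => (mulRoot_mk _ _).symm) (fun a => (mulRoot_mk _ _).symm)
  change AdjoinRoot.mk p a = 0 ↔ AdjoinRoot.mk q a = 0
  rw [AdjoinRoot.mk_eq_zero, AdjoinRoot.mk_eq_zero, h.dvd_iff_dvd_left]

open Classical in
theorem HasCyclicType.map_normalize {L : List F[X]} :
    ∀ {V : Type u} [AddCommGroup V] [Module F V] {f : Module.End F V},
      HasCyclicType L f → HasCyclicType (L.map normalize) f := by
  induction L with
  | nil => exact fun h => h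
  | cons p L ih =>
    rintro V _ _ f ⟨W, _, _, g, hg, hs⟩
    exact ⟨W, _, _, g, ih hg,
      hs.trans ((sim_mulRoot_of_associated (normalize_associated p).symm).prod (Sim.refl _))⟩

theorem HasCyclicType.filter {L : List F[X]} (hL : ∀ p ∈ L, p.Monic) :
    ∀ {V : Type u} [AddCommGroup V] [Module F V] {f : Module.End F V},
      HasCyclicType L f → HasCyclicType (L.filter fun p => 0 < p.natDegree) f := by
  induction L with
  | nil => exact fun h => h
  | cons p L ih =>
    intro V _ _ f h
    rw [List.forall_mem_cons] at hL
    by_cases hp : 0 < p.natDegree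
    · rw [List.filter_cons_of_pos (by simpa using hp)]
      obtain ⟨W, _, _, g, hg, hs⟩ := h
      exact ⟨W, _, _, g, ih hL.2 hg, hs⟩
    · rw [List.filter_cons_of_neg (by simpa using hp)]
      rw [hL.1.natDegree_eq_zero.1 (by omega)] at h
      exact ih hL.2 h.of_cons_one

/-- Existence of a decomposition into cyclic summands, from the structure theorem for torsion
modules over `F[X]`. -/
theorem exists_hasCyclicType [FiniteDimensional F V] (f : Module.End F V) :
    ∃ L : List F[X], (∀ p ∈ L, p.Monic ∧ 0 < p.natDegree) ∧ HasCyclicType L f := by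
  classical
  obtain ⟨ι, _, p, hp, k, ⟨e⟩⟩ := Module.equiv_directSum_of_isTorsion
    (Module.AEval.isTorsion_of_finiteDimensional F V f)
  let r := (Fintype.equivFin ι).symm
  let P : Fin (Fintype.card ι) → F[X] := fun i => p (r i) ^ k (r i)
  let φ : Module.AEval' f →ₗ[F[X]]
      (∀ i : Fin (Fintype.card ι), F[X] ⧸ Ideal.span {p (r i) ^ k (r i)}) :=
    LinearMap.pi fun i => DirectSum.component F[X] ι
      (fun i => F[X] ⧸ Ideal.span {p i ^ k i}) (r i) ∘ₗ e.toLinearMap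
  have hφ : Function.Bijective φ := by
    have h : ⇑φ = fun v i => (DirectSum.linearEquivFunOnFintype F[X] ι
        (fun i => F[X] ⧸ Ideal.span {p i ^ k i}) (e v)) (r i) := rfl
    rw [h]
    constructor
    · intro v w hvw
      apply e.injective
      apply (DirectSum.linearEquivFunOnFintype F[X] ι
        (fun i => F[X] ⧸ Ideal.span {p i ^ k i})).injective
      funext i
      have := congrFun hvw (r.symm i)
      simp only at this
      rw [r.apply_symm_apply] at this
      exact this
    · intro w
      obtain ⟨v, hv⟩ := (e.trans (DirectSum.linearEquivFunOnFintype F[X] ι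
        (fun i => F[X] ⧸ Ideal.span {p i ^ k i}))).surjective
        ((Equiv.piCongrLeft (fun i => F[X] ⧸ Ideal.span {p i ^ k i}) r) w)
      refine ⟨v, ?_⟩
      funext i
      have := congrFun hv (r i)
      rw [Equiv.piCongrLeft_apply_apply] at this
      exact this
  have hX : ∀ v : V, φ (Module.AEval'.of f (f v)) = (X : F[X]) • φ (Module.AEval'.of f v) := by
    intro v
    rw [← map_smul, Module.AEval'.X_smul_of]
  have hC : ∀ (c : F) (v : Module.AEval' f), φ (c • v) = c • φ v := by
    intro c v
    rw [← Module.AEval.C_smul, map_smul]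
    funext i
    obtain ⟨q, hq⟩ := AdjoinRoot.mk_surjective (φ v i)
    rw [Pi.smul_apply, Pi.smul_apply, ← hq]
    change AdjoinRoot.mk (P i) (C c * q) = c • AdjoinRoot.mk (P i) q
    rw [AdjoinRoot.smul_mk, smul_eq_C_mul]
  have hs : Sim f (LinearMap.pi fun i => mulRoot (P i) ∘ₗ LinearMap.proj i :
        Module.End F (∀ i, AdjoinRoot (P i))) := by
    refine ⟨(Module.AEval'.of f).trans (LinearEquiv.ofBijective
      ({ toFun := φ, map_add' := map_add φ, map_smul' := hC } : _ →ₗ[F] _) hφ), fun v => ?_⟩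
    change φ (Module.AEval'.of f (f v)) = _
    rw [hX]
    funext i
    change (X : F[X]) • φ (Module.AEval'.of f v) i = mulRoot (P i) (φ (Module.AEval'.of f v) i)
    obtain ⟨q, hq⟩ := AdjoinRoot.mk_surjective (φ (Module.AEval'.of f v) i)
    rw [← hq, mulRoot_mk]
    rfl
  have h := (HasCyclicType.of_sim hs (hasCyclicType_pi P)).map_normalize
  have hmon : ∀ q ∈ (List.ofFn P).map normalize, q.Monic := by
    intro q hq
    obtain ⟨q', hq', rfl⟩ := List.mem_map.1 hq
    obtain ⟨i, rfl⟩ := (List.mem_ofFn' _ _).1 hq'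
    exact Polynomial.monic_normalize (pow_ne_zero _ (hp _).ne_zero)
  refine ⟨_, fun q hq => ?_, h.filter hmon⟩
  rw [List.mem_filter] at hq
  exact ⟨hmon q hq.1, by simpa using hq.2⟩

/-- The grading of `F[X] / (X ^ k)` by parity of degree. -/
theorem OddEnd.mulRoot_X_pow (k : ℕ) : OddEnd (mulRoot (X ^ k : F[X])) := by
  let J : AdjoinRoot (X ^ k : F[X]) →ₐ[F] AdjoinRoot (X ^ k : F[X]) :=
    AdjoinRoot.liftAlgHom _ (Algebra.ofId F _) (-AdjoinRoot.root (X ^ k)) (by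
      have := AdjoinRoot.eval₂_root (X ^ k : F[X])
      rw [eval₂_pow, eval₂_X] at this ⊢
      rw [neg_pow, this, mul_zero])
  have hJ : J (AdjoinRoot.root _) = -AdjoinRoot.root _ := AdjoinRoot.liftAlgHom_root ..
  refine ⟨J.toLinearMap, ?_, ?_⟩
  · have : J.comp J = AlgHom.id F _ := by
      apply AdjoinRoot.algHom_ext
      simp [hJ]
    exact congrArg AlgHom.toLinearMap this
  · ext v
    change J (AdjoinRoot.root _ * v) = -(AdjoinRoot.root _ * J v)
    rw [map_mul, hJ, neg_mul]

theorem prodMap_pow (f : Module.End F V) (g : Module.End F W) (n : ℕ) :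
    (f.prodMap g) ^ n = (f ^ n).prodMap (g ^ n) :=
  (map_pow (LinearMap.prodMapAlgHom F V W) (f, g) n).symm

theorem HasCyclicType.oddEnd_of_pow_eq_zero {L : List F[X]} {N : ℕ} (hL : ∀ p ∈ L, p.Monic) :
    ∀ {V : Type u} [AddCommGroup V] [Module F V] {f : Module.End F V},
      HasCyclicType L f → f ^ N = 0 → OddEnd f := by
  induction L with
  | nil =>
    intro V _ _ f h _
    have : Subsingleton V := h
    exact OddEnd.of_subsingleton f
  | cons p L ih =>
    rintro V _ _ f ⟨W, _, _, g, hg, hs⟩ hN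
    rw [List.forall_mem_cons] at hL
    obtain ⟨e, he⟩ := hs.exists_conj
    have hpow : ((mulRoot p).prodMap g) ^ N = 0 := by
      have : ∀ n, e.conj (f ^ n) = (e.conj f) ^ n := by
        intro n
        induction n with
        | zero => rw [pow_zero, pow_zero]; exact LinearEquiv.conj_id e
        | succ n ih => rw [pow_succ, pow_succ, conj_mul', ih]
      rw [← he, ← this, hN, map_zero]
    rw [prodMap_pow] at hpow
    refine OddEnd.of_sim hs (OddEnd.prod ?_ (ih hL.2 hg ?_))
    · have h1 : AdjoinRoot.mk p (X ^ N) = 0 := by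
        have := LinearMap.congr_fun hpow (1, 0)
        have := congrArg Prod.fst this
        simpa [mulRoot_pow_apply] using this
      rw [AdjoinRoot.mk_eq_zero] at h1
      obtain ⟨k, -, hk⟩ := (dvd_prime_pow Polynomial.prime_X N).1 h1
      rw [Polynomial.eq_of_monic_of_associated hL.1 (monic_X_pow k) hk]
      exact OddEnd.mulRoot_X_pow k
    · ext w
      simpa using congrArg Prod.snd (LinearMap.congr_fun hpow (0, w))

/-- A nilpotent endomorphism anticommutes with an involution: it is a direct sum of
`mulRoot (X ^ k)`. -/
theorem OddEnd.of_isNilpotent [FiniteDimensional F V] {f : Module.End F V} (hf : IsNilpotent f) :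
    OddEnd f := by
  obtain ⟨N, hN⟩ := hf
  obtain ⟨L, hL, h⟩ := exists_hasCyclicType f
  exact h.oddEnd_of_pow_eq_zero (fun p hp => (hL p hp).1) hN

end Structure

/-! ### Reduced decompositions -/

section Reduced

variable {F : Type u} [Field F]
variable {V W U : Type u} [AddCommGroup V] [Module F V] [AddCommGroup W] [Module F W]
  [AddCommGroup U] [Module F U]

theorem exists_perm_cons_cons_of_not_pairwise {α : Type*} {R : α → α → Prop} {L : List α}
    (h : ¬ L.Pairwise R) : ∃ a b L', L.Perm (a :: b :: L') ∧ ¬ R a b := by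
  induction L with
  | nil => exact absurd List.Pairwise.nil h
  | cons a L ih =>
    rw [List.pairwise_cons, not_and_or] at h
    rcases h with h | h
    · push Not at h
      obtain ⟨b, hb, hab⟩ := h
      obtain ⟨s, t, rfl⟩ := List.append_of_mem hb
      exact ⟨a, b, s ++ t, List.perm_middle.cons a, hab⟩
    · obtain ⟨b, c, L', hL', hbc⟩ := ih h
      exact ⟨b, c, a :: L', (hL'.cons a).trans ((List.Perm.swap b a _).trans
        ((List.Perm.swap c a _).cons b)), hbc⟩

/-- The properties of the list of nonconstant invariant polynomials that the construction needs:
any two members have a common root, and the members of degree two coincide. -/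
def ReducedList (L : List F[X]) : Prop :=
  (∀ p ∈ L, p.Monic ∧ 0 < p.natDegree) ∧
    L.Pairwise fun p q => ¬ IsCoprime p q ∧ (p.natDegree = 2 → q.natDegree = 2 → p = q)

theorem exists_common_root [IsAlgClosed F] {p q : F[X]} (hp : p ≠ 0) (h : ¬ IsCoprime p q) :
    ∃ c : F, X - C c ∣ p ∧ X - C c ∣ q := by
  classical
  rw [← EuclideanDomain.gcd_isUnit_iff] at h
  have h0 : EuclideanDomain.gcd p q ≠ 0 := fun H => hp (EuclideanDomain.gcd_eq_zero_iff.1 H).1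
  obtain ⟨c, hc⟩ := IsAlgClosed.exists_root (EuclideanDomain.gcd p q)
    (fun H => h (isUnit_iff_degree_eq_zero.2 H))
  have := dvd_iff_isRoot.2 hc
  exact ⟨c, this.trans (EuclideanDomain.gcd_dvd_left p q),
    this.trans (EuclideanDomain.gcd_dvd_right p q)⟩

theorem exists_eq_mul_X_sub_C {p : F[X]} {c : F} (hp : p.Monic) (h2 : p.natDegree = 2)
    (h : X - C c ∣ p) : ∃ a : F, p = (X - C c) * (X - C a) := by
  obtain ⟨r, rfl⟩ := h
  have hr : r.Monic := (monic_X_sub_C c).of_mul_monic_left hp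
  rw [(monic_X_sub_C c).natDegree_mul hr, natDegree_X_sub_C] at h2
  refine ⟨-r.coeff 0, ?_⟩
  rw [hr.eq_X_add_C (by omega)]
  simp

theorem sum_sq_le_sq_sum (L : List ℕ) : (L.map (· ^ 2)).sum ≤ L.sum ^ 2 := by
  induction L with
  | nil => simp
  | cons a L ih => simp only [List.map_cons, List.sum_cons]; nlinarith [Nat.zero_le (a * L.sum)]

/-- A decomposition into cyclic summands can be chosen reduced: each violation of reducedness
allows two summands to be exchanged for others with a larger sum of squares of dimensions. -/
theorem exists_reducedList [IsAlgClosed F] [FiniteDimensional F V] (f : Module.End F V) :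
    ∃ L : List F[X], ReducedList L ∧ HasCyclicType L f := by
  obtain ⟨L, hL, hf⟩ := exists_hasCyclicType f
  obtain ⟨k, hk⟩ : ∃ k, k = Module.finrank F V ^ 2 - ((L.map natDegree).map (· ^ 2)).sum := ⟨_, rfl⟩
  induction k using Nat.strong_induction_on generalizing L with
  | _ k ih =>
    by_cases hred : L.Pairwise fun p q => ¬ IsCoprime p q ∧
        (p.natDegree = 2 → q.natDegree = 2 → p = q)
    · exact ⟨L, ⟨hL, hred⟩, hf⟩
    obtain ⟨p, q, L', hperm, hpq⟩ := exists_perm_cons_cons_of_not_pairwise hred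
    have hmem : ∀ r ∈ p :: q :: L', r.Monic ∧ 0 < r.natDegree :=
      fun r hr => hL r (hperm.mem_iff.2 hr)
    obtain ⟨hp, hp0⟩ := hmem p (by simp)
    obtain ⟨hq, hq0⟩ := hmem q (by simp)
    have hL' : ∀ r ∈ L', r.Monic ∧ 0 < r.natDegree := fun r hr => hmem r (by simp [hr])
    have hsum : ((L.map natDegree).map (· ^ 2)).sum =
        p.natDegree ^ 2 + (q.natDegree ^ 2 + ((L'.map natDegree).map (· ^ 2)).sum) := by
      rw [((hperm.map natDegree).map (· ^ 2)).sum_eq]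
      simp
    replace hf := hf.perm hperm
    -- it suffices to reach a decomposition with a larger sum of squares
    suffices H : ∃ M : List F[X], (∀ p ∈ M, p.Monic ∧ 0 < p.natDegree) ∧ HasCyclicType M f ∧
        ((L.map natDegree).map (· ^ 2)).sum < ((M.map natDegree).map (· ^ 2)).sum by
      obtain ⟨M, hM, hfM, hlt⟩ := H
      have hle := sum_sq_le_sq_sum (M.map natDegree)
      rw [← (hfM.finiteDimensional fun p hp => (hM p hp).1).2] at hle
      exact ih _ (by omega) M hM hfM rfl
    by_cases hco : IsCoprime p q
    · refine ⟨(p * q) :: L', ?_, hf.merge hco, ?_⟩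
      · rw [List.forall_mem_cons]
        exact ⟨⟨hp.mul hq, by rw [hp.natDegree_mul hq]; omega⟩, hL'⟩
      · rw [hsum]
        simp only [List.map_cons, List.sum_cons, hp.natDegree_mul hq]
        nlinarith
    · have h22 : p.natDegree = 2 ∧ q.natDegree = 2 ∧ p ≠ q := by
        by_contra H
        exact hpq ⟨hco, fun h1 h2 => by by_contra h3; exact H ⟨h1, h2, h3⟩⟩
      obtain ⟨hp2, hq2, hne⟩ := h22
      obtain ⟨c, hcp, hcq⟩ := exists_common_root hp.ne_zero hco
      obtain ⟨a, rfl⟩ := exists_eq_mul_X_sub_C hp hp2 hcp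
      obtain ⟨b, rfl⟩ := exists_eq_mul_X_sub_C hq hq2 hcq
      have hab : a ≠ b := fun h => hne (by rw [h])
      have hcop : ∀ {x y : F}, x ≠ y → IsCoprime (X - C x) (X - C y) :=
        fun h => isCoprime_X_sub_C_of_isUnit_sub (sub_ne_zero.2 h).isUnit
      -- `(X - c)(X - x)` and `(X - c)(X - y)` are exchanged for `X - c` and
      -- `(X - x)(X - c)(X - y)`, provided `x ≠ c`
      have main : ∀ x y : F, x ≠ y → x ≠ c → HasCyclicType
          (((X - C c) * (X - C x)) :: ((X - C c) * (X - C y)) :: L') f →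
          HasCyclicType ((X - C c) :: ((X - C x) * ((X - C c) * (X - C y))) :: L') f := by
        intro x y hxy hxc h
        have h1 := h.split (hcop hxc.symm)
        have h5 : HasCyclicType ((X - C x) :: ((X - C c) * (X - C y)) :: (X - C c) :: L') f :=
          h1.perm ((List.Perm.swap _ _ _).trans ((List.Perm.swap _ _ _).cons _))
        exact (h5.merge ((hcop hxc).mul_right (hcop hxy))).perm (List.Perm.swap _ _ _)
      have deg3 : ∀ x y : F, ((X - C x) * ((X - C c) * (X - C y))).Monic ∧
          ((X - C x) * ((X - C c) * (X - C y))).natDegree = 3 := by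
        intro x y
        refine ⟨(monic_X_sub_C x).mul ((monic_X_sub_C c).mul (monic_X_sub_C y)), ?_⟩
        rw [(monic_X_sub_C x).natDegree_mul ((monic_X_sub_C c).mul (monic_X_sub_C y)),
          (monic_X_sub_C c).natDegree_mul (monic_X_sub_C y)]
        simp
      have fin : ∀ x y : F,
          HasCyclicType ((X - C c) :: ((X - C x) * ((X - C c) * (X - C y))) :: L') f →
          ∃ M : List F[X], (∀ p ∈ M, p.Monic ∧ 0 < p.natDegree) ∧ HasCyclicType M f ∧
            ((L.map natDegree).map (· ^ 2)).sum < ((M.map natDegree).map (· ^ 2)).sum := by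
        intro x y h
        refine ⟨_, ?_, h, ?_⟩
        · rw [List.forall_mem_cons, List.forall_mem_cons]
          exact ⟨⟨monic_X_sub_C c, by simp⟩, ⟨(deg3 x y).1, by rw [(deg3 x y).2]; omega⟩, hL'⟩
        · rw [hsum, hp2, hq2]
          simp only [List.map_cons, List.sum_cons, (deg3 x y).2, natDegree_X_sub_C]
          omega
      by_cases hac : a = c
      · have hbc : b ≠ c := fun h => hab (hac.trans h.symm)
        exact fin b a (main b a hab.symm hbc (hf.perm (List.Perm.swap _ _ _)))
      · exact fin a b (main a b hab hac hf)

end Reduced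

/-! ### From the Smith form to a cyclic decomposition -/

section Smith

variable {F : Type u} [Field F] {n : ℕ}

/-- The surjection `F[X]^n → F^n` that sends the `i`-th standard basis vector to the `i`-th standard
basis vector and is linear over `F[X]`, where `X` acts on `F^n` through the matrix `A`. It is
recorded as an `F`-linear map. -/
noncomputable def evalAt (A : Matrix (Fin n) (Fin n) F) :
    (Fin n → F[X]) →ₗ[F] (Fin n → F) :=
  ∑ i : Fin n, (LinearMap.applyₗ (Pi.single i (1 : F) : Fin n → F)) ∘ₗ
      (aeval (Matrix.toLin' A)).toLinearMap ∘ₗ LinearMap.proj i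

theorem evalAt_apply (A : Matrix (Fin n) (Fin n) F) (v : Fin n → F[X]) :
    evalAt A v = ∑ i, aeval (Matrix.toLin' A) (v i) (Pi.single i (1 : F)) := by
  simp [evalAt, LinearMap.sum_apply]

theorem evalAt_X_smul (A : Matrix (Fin n) (Fin n) F) (v : Fin n → F[X]) :
    evalAt A ((X : F[X]) • v) = Matrix.toLin' A (evalAt A v) := by
  simp [evalAt_apply, map_sum, -Matrix.toLin'_apply]

theorem evalAt_C (A : Matrix (Fin n) (Fin n) F) (u : Fin n → F) :
    evalAt A (fun i => C (u i)) = u := by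
  rw [evalAt_apply]
  funext j
  simp [Finset.sum_apply, Pi.single_apply]

theorem charmatrix_mulVec (A : Matrix (Fin n) (Fin n) F) (w : Fin n → F[X]) :
    A.charmatrix.mulVec w = (X : F[X]) • w - (A.map C).mulVec w := by
  rw [Matrix.charmatrix, Matrix.sub_mulVec]
  congr 1
  funext i
  simp [Matrix.mulVec_diagonal, Matrix.scalar_apply]

theorem evalAt_map_C_mulVec (A : Matrix (Fin n) (Fin n) F) (w : Fin n → F[X]) :
    evalAt A ((A.map C).mulVec w) = Matrix.toLin' A (evalAt A w) := by
  have h : ∀ i j, aeval (Matrix.toLin' A) (C (A i j) * w j) =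
      A i j • aeval (Matrix.toLin' A) (w j) := by
    intro i j; rw [← smul_eq_C_mul, map_smul]
  have hcol : ∀ j, Matrix.toLin' A (Pi.single j 1) = ∑ i, A i j • (Pi.single i (1 : F)) := by
    intro j; funext k; simp [Finset.sum_apply, Pi.single_apply]
  rw [evalAt_apply, evalAt_apply, map_sum]
  simp only [Matrix.mulVec, dotProduct, Matrix.map_apply, map_sum, h, LinearMap.sum_apply,
    LinearMap.smul_apply]
  rw [Finset.sum_comm]
  refine Finset.sum_congr rfl fun j _ => ?_
  have hc : Matrix.toLin' A (aeval (Matrix.toLin' A) (w j) (Pi.single j 1)) =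
      aeval (Matrix.toLin' A) (w j) (Matrix.toLin' A (Pi.single j 1)) := by
    have : Commute (Matrix.toLin' A) (aeval (Matrix.toLin' A) (w j)) := by
      conv_lhs => rw [← aeval_X (R := F) (Matrix.toLin' A)]
      exact Commute.map (Commute.all X (w j)) (aeval (Matrix.toLin' A))
    exact LinearMap.congr_fun this.eq _
  rw [hc, hcol, map_sum]
  exact Finset.sum_congr rfl fun i _ => (map_smul _ _ _).symm

/-- Division by the characteristic matrix: every polynomial vector is congruent to a constant one
modulo the image of `X - A`. -/
theorem exists_eq_C_add_charmatrix (A : Matrix (Fin n) (Fin n) F) (v : Fin n → F[X]) :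
    ∃ w, v = (fun i => C (evalAt A v i)) + A.charmatrix.mulVec w := by
  have hadd : ∀ v v', (∃ w, v = (fun i => C (evalAt A v i)) + A.charmatrix.mulVec w) →
      (∃ w, v' = (fun i => C (evalAt A v' i)) + A.charmatrix.mulVec w) →
      ∃ w, v + v' = (fun i => C (evalAt A (v + v') i)) + A.charmatrix.mulVec w := by
    rintro v v' ⟨w, hw⟩ ⟨w', hw'⟩
    refine ⟨w + w', ?_⟩
    rw [Matrix.mulVec_add, map_add]
    nth_rw 1 [hw, hw']
    funext i
    simp only [Pi.add_apply, map_add]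
    ring
  have hX : ∀ v, (∃ w, v = (fun i => C (evalAt A v i)) + A.charmatrix.mulVec w) →
      ∃ w, (X : F[X]) • v = (fun i => C (evalAt A ((X : F[X]) • v) i)) +
        A.charmatrix.mulVec w := by
    rintro v ⟨w, hw⟩
    refine ⟨(fun i => C (evalAt A v i)) + (X : F[X]) • w, ?_⟩
    have hCA : (A.map C).mulVec (fun i => C (evalAt A v i)) =
        fun i => C (Matrix.toLin' A (evalAt A v) i) := by
      funext i
      simp [Matrix.mulVec, dotProduct]
    rw [Matrix.mulVec_add, charmatrix_mulVec A (fun i => C (evalAt A v i)), Matrix.mulVec_smul,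
      evalAt_X_smul, hCA]
    nth_rw 1 [hw]
    rw [smul_add]
    abel
  have hconst : ∀ u : Fin n → F, ∃ w, (fun i => C (u i)) =
      (fun i => C (evalAt A (fun i => C (u i)) i)) + A.charmatrix.mulVec w := fun u =>
    ⟨0, by rw [evalAt_C, Matrix.mulVec_zero, add_zero]⟩
  have hsingle : ∀ (i : Fin n) (p : F[X]), ∃ w, (Pi.single i p : Fin n → F[X]) =
      (fun j => C (evalAt A (Pi.single i p) j)) + A.charmatrix.mulVec w := by
    intro i p
    have hc0 : ∀ a : F, (Pi.single i (C a) : Fin n → F[X]) =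
        fun j => C ((Pi.single i a : Fin n → F) j) := by
      intro a
      funext j
      by_cases h : j = i
      · subst h; simp
      · simp [h]
    induction p using Polynomial.induction_on with
    | C a => rw [hc0]; exact hconst _
    | add p q hp hq => rw [Pi.single_add]; exact hadd _ _ hp hq
    | monomial k a ih =>
      have : (Pi.single i (C a * X ^ (k + 1)) : Fin n → F[X]) =
          (X : F[X]) • Pi.single i (C a * X ^ k) := by
        rw [← Pi.single_smul, smul_eq_mul]
        congr 1
        ring
      rw [this]
      exact hX _ ih
  rw [← Finset.univ_sum_single v]
  refine Finset.sum_induction _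
    (fun v => ∃ w, v = (fun i => C (evalAt A v i)) + A.charmatrix.mulVec w) hadd ?_
    (fun i _ => hsingle i (v i))
  exact ⟨0, by funext i; simp⟩

/-- The `F[X]`-module `F^n` defined by `A` is presented by the characteristic matrix. -/
theorem evalAt_eq_zero_iff (A : Matrix (Fin n) (Fin n) F) (v : Fin n → F[X]) :
    evalAt A v = 0 ↔ ∃ w, v = A.charmatrix.mulVec w := by
  constructor
  · intro h
    obtain ⟨w, hw⟩ := exists_eq_C_add_charmatrix A v
    refine ⟨w, hw.trans ?_⟩
    rw [h]
    funext i
    simp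
  · rintro ⟨w, rfl⟩
    rw [charmatrix_mulVec, map_sub, evalAt_X_smul, evalAt_map_C_mulVec, sub_self]

/-- The cyclic type of a matrix is read off the Smith form of its characteristic matrix. -/
theorem hasCyclicType_of_isInvariantPolynomials {A : Matrix (Fin n) (Fin n) F}
    {f : Fin n → F[X]} (hf : IsInvariantPolynomials A f) :
    HasCyclicType (List.ofFn f) (Matrix.toLin' A) := by
  obtain ⟨-, -, S, T, hS, hT, hST⟩ := hf
  obtain ⟨S', hS₁⟩ := hS.exists_left_inv
  obtain ⟨S'', hS₂⟩ := hS.exists_right_inv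
  obtain ⟨T', hT₂⟩ := hT.exists_right_inv
  refine HasCyclicType.of_sim (sim_of_surjective (x := LinearMap.lsmul F[X] (Fin n → F[X]) X
      |>.restrictScalars F) (evalAt A)
    (LinearMap.pi fun i => (AdjoinRoot.mkₐ (f i)).toLinearMap ∘ₗ LinearMap.proj i ∘ₗ
      (Matrix.toLin' S).restrictScalars F) ?_ ?_ ?_ ?_ ?_) (hasCyclicType_pi f)
  · exact fun u => ⟨_, evalAt_C A u⟩
  · intro v
    choose q hq using fun i => AdjoinRoot.mk_surjective (v i)
    refine ⟨S''.mulVec q, ?_⟩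
    funext i
    change AdjoinRoot.mk (f i) ((S.mulVec (S''.mulVec q)) i) = v i
    rw [Matrix.mulVec_mulVec, hS₂, Matrix.one_mulVec, hq]
  · intro u
    have hψ : (LinearMap.pi fun i => (AdjoinRoot.mkₐ (f i)).toLinearMap ∘ₗ LinearMap.proj i ∘ₗ
        (Matrix.toLin' S).restrictScalars F) u = 0 ↔
        ∃ w, S.mulVec u = (Matrix.diagonal f).mulVec w := by
      rw [funext_iff]
      have : ∀ i, (LinearMap.pi fun i => (AdjoinRoot.mkₐ (f i)).toLinearMap ∘ₗ
          LinearMap.proj i ∘ₗ (Matrix.toLin' S).restrictScalars F) u i =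
            AdjoinRoot.mk (f i) ((S.mulVec u) i) := fun i => rfl
      simp only [this, Pi.zero_apply, AdjoinRoot.mk_eq_zero]
      constructor
      · intro h
        choose w hw using h
        exact ⟨w, funext fun i => by rw [hw, Matrix.mulVec_diagonal]⟩
      · rintro ⟨w, hw⟩ i
        rw [hw, Matrix.mulVec_diagonal]
        exact dvd_mul_right _ _
    rw [hψ, evalAt_eq_zero_iff, ← hST]
    constructor
    · rintro ⟨w, rfl⟩
      refine ⟨T'.mulVec w, ?_⟩
      rw [Matrix.mulVec_mulVec, Matrix.mulVec_mulVec, Matrix.mul_assoc, hT₂, Matrix.mul_one]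
    · rintro ⟨w, hw⟩
      refine ⟨T.mulVec w, ?_⟩
      have := congrArg S'.mulVec hw
      rw [Matrix.mulVec_mulVec, hS₁, Matrix.one_mulVec, Matrix.mulVec_mulVec, Matrix.mul_assoc S,
        ← Matrix.mul_assoc S', hS₁, Matrix.one_mul] at this
      rw [this, Matrix.mulVec_mulVec]
  · exact evalAt_X_smul A
  · intro u
    funext i
    change AdjoinRoot.mk (f i) ((S.mulVec ((X : F[X]) • u)) i) =
      mulRoot (f i) (AdjoinRoot.mk (f i) ((S.mulVec u) i))
    rw [mulRoot_mk, Matrix.mulVec_smul]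
    rfl

/-- In a divisibility chain no two nonconstant members are coprime, and members of the same degree
are equal. -/
theorem reducedList_filter_ofFn {f : Fin n → F[X]} (hmon : ∀ i, (f i).Monic)
    (hdvd : ∀ i j, i ≤ j → f i ∣ f j) :
    ReducedList ((List.ofFn f).filter fun p => 0 < p.natDegree) := by
  refine ⟨fun p hp => ?_, ?_⟩
  · rw [List.mem_filter, List.mem_ofFn'] at hp
    obtain ⟨⟨i, rfl⟩, h⟩ := hp
    exact ⟨hmon i, by simpa using h⟩
  · rw [List.pairwise_filter, List.pairwise_ofFn]
    intro i j hij hi _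
    have hd := hdvd i j hij.le
    refine ⟨fun h => ?_, fun hi2 hj2 => ?_⟩
    · have := h.isUnit_of_dvd' dvd_rfl hd
      rw [(hmon i).isUnit_iff] at this
      simp [this] at hi
    · exact (Polynomial.eq_of_monic_of_dvd_of_natDegree_le (hmon i) (hmon j) hd (by omega)).symm

theorem countP_ofFn {α : Type*} (P : α → Prop) [DecidablePred P] :
    ∀ {n : ℕ} (f : Fin n → α),
      (List.ofFn f).countP (fun a => P a) = (Finset.univ.filter fun i => P (f i)).card
  | 0, f => by simp
  | n + 1, f => by
    rw [List.ofFn_succ, List.countP_cons, countP_ofFn P (fun i : Fin n => f i.succ),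
      Fin.card_filter_univ_succ]
    by_cases h : P (f 0) <;> simp [h]

theorem countP_filter_ofFn (f : Fin n → F[X]) :
    ((List.ofFn f).filter fun p => 0 < p.natDegree).countP (fun p => p.natDegree = 2) =
      numDegreeTwo f := by
  rw [List.countP_filter, numDegreeTwo, ← countP_ofFn (fun p : F[X] => p.natDegree = 2)]
  refine List.countP_congr fun p _ => ?_
  simp only [Bool.and_eq_true, decide_eq_true_eq]
  omega

end Smith

/-! ### Linkable endomorphisms -/

section Link

variable {F : Type u} [Field F]
variable {V W U : Type u} [AddCommGroup V] [Module F V] [AddCommGroup W] [Module F W]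
  [AddCommGroup U] [Module F U]

/-- `HasEnds D y z`: the endomorphism `D` is the direct sum of the scalars `y` and `-z` and of an
odd endomorphism. -/
def HasEnds (D : Module.End F V) (y z : F) : Prop :=
  ∃ (W : Type u) (_ : AddCommGroup W) (_ : Module F W) (K : Module.End F W), OddEnd K ∧
    Sim D ((y • (1 : Module.End F F)).prodMap (((-z) • (1 : Module.End F F)).prodMap K))

theorem HasEnds.of_sim {D : Module.End F V} {E : Module.End F W} {y z : F} (h : Sim D E)
    (hE : HasEnds E y z) : HasEnds D y z := by
  obtain ⟨U, _, _, K, hK, hs⟩ := hE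
  exact ⟨U, _, _, K, hK, h.trans hs⟩

theorem OddEnd.smul_prod_neg_smul (z : F) :
    OddEnd (((-z) • (1 : Module.End F V)).prodMap (z • (1 : Module.End F V))) := by
  rw [neg_smul]
  exact OddEnd.neg_prod _

/-- The end `-z` of the first summand and the end `z` of the second one cancel. -/
theorem HasEnds.prod {D : Module.End F V} {E : Module.End F W} {x y z : F}
    (hD : HasEnds D x y) (hE : HasEnds E y z) : HasEnds (D.prodMap E) x z := by
  obtain ⟨U, _, _, K, hK, hs⟩ := hD
  obtain ⟨U', _, _, K', hK', hs'⟩ := hE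
  refine ⟨(F × F) × (U × U'), inferInstance, inferInstance, _,
    (OddEnd.smul_prod_neg_smul (V := F) y).prod (hK.prod hK'), (hs.prod hs').trans ?_⟩
  refine (Sim.prodAssoc _ _ _).trans ((Sim.refl _).prod ?_)
  -- regroup `(-y × K) × (y × (-z × K'))` as `-z × ((-y × y) × (K × K'))`
  refine ((Sim.prodProdProdComm _ _ _ _).trans ?_)
  refine Sim.trans ?_ (Sim.prodLeftComm _ _ _)
  exact (Sim.refl _).prod (Sim.prodLeftComm _ _ _)

/-- If both ends agree, they cancel each other. -/
theorem HasEnds.oddEnd {D : Module.End F V} {y : F} (h : HasEnds D y y) : OddEnd D := by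
  obtain ⟨U, _, _, K, hK, hs⟩ := h
  refine OddEnd.of_sim (hs.trans (Sim.prodAssoc _ _ _).symm) (OddEnd.prod ?_ hK)
  exact (OddEnd.smul_prod_neg_smul y).of_sim (Sim.prodComm _ _)

/-- `B` is linkable if for all but finitely many `y` it becomes, after subtraction of a square-zero
endomorphism, a direct sum of `y`, of `-z` and of an odd endomorphism; here `z` is determined by
the trace. Direct sums of linkable endomorphisms are linkable because the ends can be chosen to
cancel. -/
def Linkable (B : Module.End F V) : Prop :=
  ∃ bad : Finset F, ∀ y ∉ bad, ∃ S : Module.End F V, S * S = 0 ∧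
    HasEnds (B - S) y (y - LinearMap.trace F V B)

theorem Linkable.of_sim {B : Module.End F V} {C : Module.End F W} (h : Sim B C)
    (hC : Linkable C) : Linkable B := by
  obtain ⟨bad, hbad⟩ := hC
  refine ⟨bad, fun y hy => ?_⟩
  obtain ⟨S, hS, hE⟩ := hbad y hy
  rw [← h.trace_eq] at hE
  obtain ⟨e, he⟩ := h.symm.exists_conj
  refine ⟨e.conj S, by rw [← conj_mul', hS, map_zero], ?_⟩
  rw [← he] at hE ⊢
  rw [← map_sub]
  exact hE.of_sim (Sim.conj e).symm

theorem Linkable.prod [FiniteDimensional F V] [FiniteDimensional F W] {B : Module.End F V}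
    {C : Module.End F W} (hB : Linkable B) (hC : Linkable C) : Linkable (B.prodMap C) := by
  classical
  obtain ⟨bad, hbad⟩ := hB
  obtain ⟨bad', hbad'⟩ := hC
  refine ⟨bad ∪ bad'.image (· + LinearMap.trace F V B), fun y hy => ?_⟩
  rw [Finset.mem_union, not_or, Finset.mem_image] at hy
  obtain ⟨S, hS, hE⟩ := hbad y hy.1
  obtain ⟨T, hT, hE'⟩ := hbad' (y - LinearMap.trace F V B) (fun h => hy.2 ⟨_, h, by ring⟩)
  refine ⟨S.prodMap T, ?_, ?_⟩
  · rw [LinearMap.prodMap_mul, hS, hT, LinearMap.prodMap_zero]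
  · have h : B.prodMap C - S.prodMap T = (B - S).prodMap (C - T) := by ext <;> simp
    rw [h, LinearMap.trace_prodMap', ← sub_sub]
    exact hE.prod hE'

theorem Linkable.oddModSquareZero [Infinite F] {B : Module.End F V} (hB : Linkable B)
    (htr : LinearMap.trace F V B = 0) : OddModSquareZero B := by
  obtain ⟨bad, hbad⟩ := hB
  obtain ⟨y, hy⟩ := Infinite.exists_notMem_finset bad
  obtain ⟨S, hS, hE⟩ := hbad y hy
  rw [htr, sub_zero] at hE
  exact ⟨S, hS, hE.oddEnd⟩

theorem trace_mulRoot {p : F[X]} (hp : p.Monic) (h0 : 0 < p.natDegree) :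
    LinearMap.trace F _ (mulRoot p) = -p.nextCoeff := by
  have := AdjoinRoot.nontrivial p (natDegree_pos_iff_degree_pos.1 h0).ne'
  have := (AdjoinRoot.powerBasis hp.ne_zero).trace_gen_eq_nextCoeff_minpoly
  rw [AdjoinRoot.minpoly_powerBasis_gen_of_monic hp, Algebra.trace_apply] at this
  exact this

/-- Companion endomorphisms of polynomials with the same degree and the same second coefficient
differ by a square-zero endomorphism of rank at most one: only the last column of the companion
matrices differ. -/
theorem exists_sub_sim_mulRoot {p q : F[X]} (hp : p.Monic) (hq : q.Monic)
    (hdeg : p.natDegree = q.natDegree) (hpos : 0 < p.natDegree)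
    (hnext : p.nextCoeff = q.nextCoeff) :
    ∃ S : Module.End F (AdjoinRoot p), S * S = 0 ∧ Sim (mulRoot p - S) (mulRoot q) := by
  have hd : p.degree = q.degree := by
    rw [degree_eq_natDegree hp.ne_zero, degree_eq_natDegree hq.ne_zero, hdeg]
  -- the identification of both modules with the polynomials of degree less than `n`
  let θ : AdjoinRoot p ≃ₗ[F] AdjoinRoot q :=
    { (AdjoinRoot.mkₐ q).toLinearMap ∘ₗ AdjoinRoot.modByMonicHom hp with
      invFun := (AdjoinRoot.mkₐ p).toLinearMap ∘ₗ AdjoinRoot.modByMonicHom hq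
      left_inv := fun v => by
        obtain ⟨a, rfl⟩ := AdjoinRoot.mk_surjective v
        change AdjoinRoot.mk p (AdjoinRoot.modByMonicHom hq (AdjoinRoot.mk q
          (AdjoinRoot.modByMonicHom hp (AdjoinRoot.mk p a)))) = _
        rw [AdjoinRoot.modByMonicHom_mk, AdjoinRoot.modByMonicHom_mk,
          (modByMonic_eq_self_iff hq).2 (hd ▸ degree_modByMonic_lt a hp),
          ← AdjoinRoot.modByMonicHom_mk hp, AdjoinRoot.mk_leftInverse hp]
      right_inv := fun v => by
        obtain ⟨a, rfl⟩ := AdjoinRoot.mk_surjective v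
        change AdjoinRoot.mk q (AdjoinRoot.modByMonicHom hp (AdjoinRoot.mk p
          (AdjoinRoot.modByMonicHom hq (AdjoinRoot.mk q a)))) = _
        rw [AdjoinRoot.modByMonicHom_mk, AdjoinRoot.modByMonicHom_mk,
          (modByMonic_eq_self_iff hp).2 (hd ▸ degree_modByMonic_lt a hq),
          ← AdjoinRoot.modByMonicHom_mk hq, AdjoinRoot.mk_leftInverse hq] }
  have hθ : ∀ a : F[X], a.degree < p.degree → θ (AdjoinRoot.mk p a) = AdjoinRoot.mk q a := by
    intro a ha
    change AdjoinRoot.mk q (AdjoinRoot.modByMonicHom hp (AdjoinRoot.mk p a)) = _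
    rw [AdjoinRoot.modByMonicHom_mk, (modByMonic_eq_self_iff hp).2 ha]
  have hθ' : ∀ a : F[X], a.degree < p.degree →
      θ.symm (AdjoinRoot.mk q a) = AdjoinRoot.mk p a := fun a ha => by
    rw [LinearEquiv.symm_apply_eq, hθ a ha]
  obtain ⟨m, hm⟩ : ∃ m, p.natDegree = m + 1 := ⟨p.natDegree - 1, by omega⟩
  have hpm : p.degree = ((m + 1 : ℕ) : WithBot ℕ) := by rw [degree_eq_natDegree hp.ne_zero, hm]
  have hpc : p.coeff m = q.coeff m := by
    rw [nextCoeff_of_natDegree_pos hpos, nextCoeff_of_natDegree_pos (hdeg ▸ hpos), ← hdeg,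
      hm] at hnext
    exact hnext
  have hqp : (q - p).degree < (m : WithBot ℕ) := by
    rw [degree_lt_iff_coeff_zero]
    intro k hk
    rw [coeff_sub, sub_eq_zero]
    rcases hk.eq_or_lt with rfl | hk
    · exact hpc.symm
    rcases (Nat.succ_le_of_lt hk).eq_or_lt with hk | hk
    · have h1 := hp.coeff_natDegree
      have h2 := hq.coeff_natDegree
      rw [← hdeg] at h2
      rw [hm] at h1 h2
      rw [← hk]
      exact h2.trans h1.symm
    · rw [coeff_eq_zero_of_natDegree_lt (by omega), coeff_eq_zero_of_natDegree_lt (by omega)]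
  let S : Module.End F (AdjoinRoot p) := mulRoot p - θ.symm.conj (mulRoot q)
  have hS : ∀ a : F[X], a.degree < p.degree →
      S (AdjoinRoot.mk p a) = a.coeff m • AdjoinRoot.mk p (q - p) := by
    intro a ha
    have hred : AdjoinRoot.mk q (X * a) = AdjoinRoot.mk q (X * a - a.coeff m • q) := by
      rw [AdjoinRoot.mk_eq_mk, smul_eq_C_mul]
      exact ⟨C (a.coeff m), by ring⟩
    have hlt : (X * a - a.coeff m • q).degree < p.degree := by
      rw [hpm, degree_lt_iff_coeff_zero]
      intro k hk
      obtain ⟨k, rfl⟩ : ∃ l, k = l + 1 := ⟨k - 1, by omega⟩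
      rw [coeff_sub, coeff_X_mul, coeff_smul, smul_eq_mul, sub_eq_zero]
      rcases (Nat.le_of_succ_le_succ hk).eq_or_lt with rfl | hk
      · have := hq.coeff_natDegree
        rw [← hdeg, hm] at this
        rw [this, mul_one]
      · rw [coeff_eq_zero_of_degree_lt (lt_of_lt_of_le ha (by rw [hpm]; exact_mod_cast hk)),
          coeff_eq_zero_of_natDegree_lt (n := k + 1) (by omega), mul_zero]
    change mulRoot p (AdjoinRoot.mk p a) -
      θ.symm (mulRoot q (θ (AdjoinRoot.mk p a))) = _
    rw [hθ a ha, mulRoot_mk, mulRoot_mk, hred, hθ' _ hlt, ← map_sub, AdjoinRoot.smul_mk,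
      AdjoinRoot.mk_eq_mk]
    refine ⟨C (a.coeff m), ?_⟩
    rw [smul_eq_C_mul, smul_eq_C_mul]
    ring
  refine ⟨S, ?_, ?_⟩
  · ext v
    have hv : v = AdjoinRoot.mk p (AdjoinRoot.modByMonicHom hp v) :=
      (AdjoinRoot.mk_leftInverse hp v).symm
    obtain ⟨a, ha⟩ := AdjoinRoot.mk_surjective v
    have hdv : (AdjoinRoot.modByMonicHom hp v).degree < p.degree := by
      rw [← ha, AdjoinRoot.modByMonicHom_mk]
      exact degree_modByMonic_lt a hp
    rw [Module.End.mul_apply, hv, hS _ hdv, map_smul,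
      hS _ (hqp.trans (by rw [hpm]; exact_mod_cast Nat.lt_succ_self m)),
      coeff_eq_zero_of_degree_lt hqp, zero_smul, smul_zero]
    rfl
  · rw [sub_sub_cancel]
    exact (Sim.conj θ.symm).symm

/-- A cyclic endomorphism of a space of dimension at least two is linkable: its companion matrix can
be changed into that of `(X - y) (X + z) X ^ (n - 2)`. -/
theorem linkable_mulRoot {p : F[X]} (hp : p.Monic) (h2 : 2 ≤ p.natDegree) [NeZero (2 : F)] :
    Linkable (mulRoot p) := by
  classical
  set t := LinearMap.trace F _ (mulRoot p) with ht
  refine ⟨{0, t, t / 2}, fun y hy => ?_⟩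
  simp only [Finset.mem_insert, Finset.mem_singleton, not_or] at hy
  obtain ⟨hy0, hyt, hyt2⟩ := hy
  set z := y - t with hz
  have hz0 : z ≠ 0 := sub_ne_zero.2 hyt
  have hyz : y ≠ -z := fun h => hyt2 (by
    rw [eq_div_iff (NeZero.ne (2 : F))]
    linear_combination h - hz)
  have hm : ((X - C (-z)) * X ^ (p.natDegree - 2) : F[X]).Monic :=
    (monic_X_sub_C _).mul (monic_X_pow _)
  obtain ⟨S, hS, hs⟩ := exists_sub_sim_mulRoot hp
    (q := (X - C y) * ((X - C (-z)) * X ^ (p.natDegree - 2)))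
    ((monic_X_sub_C _).mul hm)
    (by
      rw [(monic_X_sub_C _).natDegree_mul hm, (monic_X_sub_C _).natDegree_mul (monic_X_pow _)]
      simp only [natDegree_X_sub_C, natDegree_X_pow]
      omega) (by omega)
    (by
      rw [(monic_X_sub_C _).nextCoeff_mul hm, (monic_X_sub_C _).nextCoeff_mul (monic_X_pow _),
        nextCoeff_X_sub_C, nextCoeff_X_sub_C,
        ← neg_eq_iff_eq_neg.2 (trace_mulRoot hp (by omega)), ← ht]
      have : (X ^ (p.natDegree - 2) : F[X]).nextCoeff = 0 := by
        have := (monic_X (R := F)).nextCoeff_pow (p.natDegree - 2)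
        rw [this]
        have hX : (X : F[X]).nextCoeff = 0 := by
          have := nextCoeff_X_sub_C (0 : F)
          rwa [C_0, sub_zero, neg_zero] at this
        rw [hX, smul_zero]
      rw [this]
      linear_combination -hz)
  have hcop : ∀ {a b : F}, a ≠ b → IsCoprime (X - C a) (X - C b) :=
    fun h => isCoprime_X_sub_C_of_isUnit_sub (sub_ne_zero.2 h).isUnit
  have hcopX : ∀ {a : F} (k : ℕ), a ≠ 0 → IsCoprime (X - C a) (X ^ k) := fun {a} k h => by
    have := hcop h
    rw [C_0, sub_zero] at this
    exact this.pow_right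
  refine ⟨S, hS, _, _, _, _, OddEnd.mulRoot_X_pow (p.natDegree - 2), hs.trans ?_⟩
  refine (sim_mulRoot_mul ((hcop hyz).mul_right (hcopX _ hy0))).trans ?_
  exact (sim_mulRoot_X_sub_C y).prod
    ((sim_mulRoot_mul (hcopX _ (neg_ne_zero.2 hz0))).trans
      ((sim_mulRoot_X_sub_C (-z)).prod (Sim.refl _)))

end Link

/-! ### Block triangular endomorphisms and Hessenberg bases -/

section Blocks

variable {F : Type u} [Field F]
variable {V W Z U : Type u} [AddCommGroup V] [Module F V] [AddCommGroup W] [Module F W]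
  [AddCommGroup Z] [Module F Z] [AddCommGroup U] [Module F U]

/-- The block lower triangular endomorphism `(w, c) ↦ (f w, R w + g c)`. -/
def lowerBlock (f : Module.End F W) (R : W →ₗ[F] Z) (g : Module.End F Z) :
    Module.End F (W × Z) :=
  (f ∘ₗ LinearMap.fst F W Z).prod (R ∘ₗ LinearMap.fst F W Z + g ∘ₗ LinearMap.snd F W Z)

theorem lowerBlock_apply (f : Module.End F W) (R : W →ₗ[F] Z) (g : Module.End F Z) (v : W × Z) :
    lowerBlock f R g v = (f v.1, R v.1 + g v.2) := rfl

/-- Conjugation by `(w, c) ↦ (w + X c, c)` changes the diagonal blocks into `f + X R` and `g - R X`;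
the upper right block that arises is square-zero and can be subtracted. -/
theorem exists_sub_sim_lowerBlock (f : Module.End F W) (R : W →ₗ[F] Z) (g : Module.End F Z)
    (X : Z →ₗ[F] W) : ∃ S : Module.End F (W × Z), S * S = 0 ∧
      Sim (lowerBlock f R g - S) (lowerBlock (f + X ∘ₗ R) R (g - R ∘ₗ X)) := by
  let Y : Z →ₗ[F] W := X ∘ₗ g - f ∘ₗ X - X ∘ₗ R ∘ₗ X
  let S : Module.End F (W × Z) := LinearMap.inl F W Z ∘ₗ Y ∘ₗ LinearMap.snd F W Z
  have hS : ∀ v, S v = (X (g v.2) - f (X v.2) - X (R (X v.2)), 0) := fun v => rfl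
  let e : (W × Z) ≃ₗ[F] (W × Z) :=
    { ((LinearMap.fst F W Z + X ∘ₗ LinearMap.snd F W Z).prod (LinearMap.snd F W Z) :
        W × Z →ₗ[F] W × Z) with
      invFun := fun v => (v.1 - X v.2, v.2)
      left_inv := fun v => Prod.ext (add_sub_cancel_right _ _) rfl
      right_inv := fun v => Prod.ext (sub_add_cancel _ _) rfl }
  have he : ∀ v, e v = (v.1 + X v.2, v.2) := fun v => rfl
  refine ⟨S, ?_, e, fun v => ?_⟩
  · ext v <;> simp [hS]
  · simp only [LinearMap.sub_apply, hS, he, lowerBlock_apply, LinearMap.add_apply,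
      LinearMap.comp_apply, map_add, Prod.fst_sub, Prod.snd_sub, sub_zero]
    refine Prod.ext ?_ ?_
    · simp only; abel
    · simp only; abel

/-- If `R w₀` generates `F[X] / (g)`, then `[[c, 0], [R, g]]` is the direct sum of a cyclic
endomorphism with polynomial `(X - c) g`, generated by `w₀`, and of a scalar. -/
theorem sim_lowerBlock_mulRoot {g : F[X]} (hg : g.Monic) (hd : 0 < g.natDegree) (c : F)
    (R : W →ₗ[F] AdjoinRoot g) (φ : W →ₗ[F] F) (w₀ : W) (hR : R w₀ = 1) (hφ : φ w₀ = 1) :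
    Sim (lowerBlock (c • (1 : Module.End F W)) R (mulRoot g))
      ((mulRoot ((X - C c) * g)).prodMap (c • (1 : Module.End F (LinearMap.ker φ)))) := by
  let ι : AdjoinRoot g →ₗ[F] AdjoinRoot ((X - C c) * g) :=
    (AdjoinRoot.mkₐ ((X - C c) * g)).toLinearMap ∘ₗ LinearMap.mulLeft F (X - C c) ∘ₗ
      AdjoinRoot.modByMonicHom hg
  let σ : W →ₗ[F] AdjoinRoot ((X - C c) * g) :=
    (AdjoinRoot.mkₐ ((X - C c) * g)).toLinearMap ∘ₗ AdjoinRoot.modByMonicHom hg ∘ₗ R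
  have hι : ∀ a, ι (AdjoinRoot.mk g a) = AdjoinRoot.mk _ ((X - C c) * a) := by
    intro a
    change AdjoinRoot.mk _ ((X - C c) * AdjoinRoot.modByMonicHom hg (AdjoinRoot.mk g a)) = _
    rw [AdjoinRoot.mk_eq_mk, ← mul_sub]
    refine mul_dvd_mul_left _ ?_
    rw [← AdjoinRoot.mk_eq_mk, AdjoinRoot.mk_leftInverse hg]
  have hσ : ∀ w, mulRoot ((X - C c) * g) (σ w) = c • σ w + ι (R w) := by
    intro w
    change mulRoot _ (AdjoinRoot.mk _ (AdjoinRoot.modByMonicHom hg (R w))) =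
      c • AdjoinRoot.mk _ (AdjoinRoot.modByMonicHom hg (R w)) +
        AdjoinRoot.mk _ ((X - C c) * AdjoinRoot.modByMonicHom hg (R w))
    rw [mulRoot_mk, AdjoinRoot.smul_mk, ← map_add, smul_eq_C_mul]
    congr 1
    ring
  have hσ₀ : σ w₀ = AdjoinRoot.mk _ 1 := by
    change AdjoinRoot.mk _ (AdjoinRoot.modByMonicHom hg (R w₀)) = _
    rw [hR, ← map_one (AdjoinRoot.mk g), AdjoinRoot.modByMonicHom_mk,
      (modByMonic_eq_self_iff hg).2]
    rw [degree_one]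
    exact natDegree_pos_iff_degree_pos.1 hd
  have hιX : ∀ v, ι (mulRoot g v) = mulRoot _ (ι v) := by
    intro v
    obtain ⟨a, rfl⟩ := AdjoinRoot.mk_surjective v
    rw [mulRoot_mk, hι, hι, mulRoot_mk, mul_left_comm]
  let τ : W →ₗ[F] LinearMap.ker φ :=
    (LinearMap.id - φ.smulRight w₀).codRestrict _ fun w => by simp [hφ]
  have hτ : ∀ w, (τ w : W) = w - φ w • w₀ := fun w => rfl
  let Θ : W × AdjoinRoot g →ₗ[F] AdjoinRoot ((X - C c) * g) × LinearMap.ker φ :=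
    (σ ∘ₗ LinearMap.fst F _ _ + ι ∘ₗ LinearMap.snd F _ _).prod (τ ∘ₗ LinearMap.fst F _ _)
  have hΘ : ∀ v, Θ v = (σ v.1 + ι v.2, τ v.1) := fun v => rfl
  have hbij : Function.Bijective Θ := by
    constructor
    · rw [← LinearMap.ker_eq_bot, LinearMap.ker_eq_bot']
      rintro ⟨w, v⟩ hv
      rw [hΘ, Prod.mk_eq_zero] at hv
      obtain ⟨h1, h2⟩ := hv
      have hw : w = φ w • w₀ := by
        rw [← sub_eq_zero, ← hτ, h2]; rfl
      obtain ⟨a, rfl⟩ := AdjoinRoot.mk_surjective v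
      simp only at h1 h2
      rw [hw, map_smul, hσ₀, hι, AdjoinRoot.smul_mk, ← map_add, AdjoinRoot.mk_eq_zero] at h1
      have h3 : φ w = 0 := by
        have h := dvd_iff_isRoot.1 (dvd_of_mul_right_dvd h1)
        simpa using h
      rw [h3, zero_smul, zero_add] at h1
      have h4 := (mul_dvd_mul_iff_left (X_sub_C_ne_zero c)).1 h1
      rw [hw, h3, zero_smul, AdjoinRoot.mk_eq_zero.2 h4]
      rfl
    · rintro ⟨h, u⟩
      obtain ⟨q, hq⟩ := AdjoinRoot.mk_surjective (h - σ u)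
      obtain ⟨r, hr⟩ := X_sub_C_dvd_sub_C_eval (p := q) (a := c)
      have hu : φ (u : W) = 0 := u.2
      refine ⟨(u + q.eval c • w₀, AdjoinRoot.mk g r), ?_⟩
      rw [hΘ]
      refine Prod.ext ?_ (Subtype.ext ?_)
      · simp only
        rw [map_add, map_smul, hσ₀, hι, ← hr, AdjoinRoot.smul_mk, add_assoc, ← map_add,
          smul_eq_C_mul, mul_one, add_sub_cancel, hq, add_sub_cancel]
      · simp only [hτ]
        rw [map_add, map_smul, hu, hφ, zero_add, smul_eq_mul, mul_one, add_sub_cancel_right]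
  refine ⟨LinearEquiv.ofBijective Θ hbij, fun v => ?_⟩
  change Θ _ = _
  rw [LinearEquiv.ofBijective_apply, lowerBlock_apply, hΘ, hΘ]
  refine Prod.ext ?_ (Subtype.ext ?_)
  · simp only [LinearMap.prodMap_apply, LinearMap.smul_apply, Module.End.one_apply, map_smul,
      map_add, hσ, hιX]
    abel
  · simp [hτ, smul_sub, smul_smul]

theorem degree_prod_X_sub_C (α : ℕ → F) (j : ℕ) :
    (∏ i ∈ Finset.range j, (X - C (α i))).degree = (j : WithBot ℕ) := by
  rw [degree_prod]
  simp

/-- A basis of `F[X] / (g)` in which multiplication by the root is in Hessenberg form: below the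
diagonal only the entries next to it can be nonzero, above the diagonal only those of the last
column. The diagonal can be prescribed, subject to the trace. -/
theorem exists_hessenberg_basis {g : F[X]} (hg : g.Monic) (α : Fin g.natDegree → F)
    (hα : ∑ i, α i = LinearMap.trace F _ (mulRoot g)) :
    ∃ b : Module.Basis (Fin g.natDegree) F (AdjoinRoot g),
      (∀ i, LinearMap.toMatrix b b (mulRoot g) i i = α i) ∧
      (∀ i j : Fin g.natDegree, i ≠ j → (j : ℕ) + 1 ≠ g.natDegree → (i : ℕ) ≠ j + 1 →
        LinearMap.toMatrix b b (mulRoot g) i j = 0) ∧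
      ∀ i : Fin g.natDegree, (i : ℕ) = 0 → b i = 1 := by
  have := finiteDimensional_adjoinRoot hg
  let α' : ℕ → F := fun i => if h : i < g.natDegree then α ⟨i, h⟩ else 0
  let s : Polynomial.Sequence F :=
    { elems' := fun j => ∏ i ∈ Finset.range j, (X - C (α' i))
      degree_eq' := degree_prod_X_sub_C α' }
  have hs : ∀ j, s j = ∏ i ∈ Finset.range j, (X - C (α' i)) := fun j => rfl
  have hli : LinearIndependent F fun j : Fin g.natDegree => AdjoinRoot.mk g (s j) := by
    rw [Fintype.linearIndependent_iff]
    intro c hc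
    simp only [AdjoinRoot.smul_mk, ← map_sum, AdjoinRoot.mk_eq_zero] at hc
    have h0 : ∑ i : Fin g.natDegree, c i • s i = 0 := by
      refine eq_zero_of_dvd_of_degree_lt hc ?_
      refine (degree_sum_le _ _).trans_lt ?_
      rw [Finset.sup_lt_iff (by rw [bot_lt_iff_ne_bot, Ne, degree_eq_bot]; exact hg.ne_zero)]
      intro i _
      refine (degree_smul_le _ _).trans_lt ?_
      rw [s.degree_eq, degree_eq_natDegree hg.ne_zero]
      exact_mod_cast i.2
    exact Fintype.linearIndependent_iff.1 (s.linearIndependent.comp _ Fin.val_injective) c h0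
  let b := Module.Basis.mk hli (hli.span_eq_top_of_card_eq_finrank'
    (by rw [finrank_adjoinRoot, Fintype.card_fin])).ge
  have hb : ∀ j, b j = AdjoinRoot.mk g (s j) := fun j => by
    simp [b]
  have hstep : ∀ j : Fin g.natDegree, ∀ h : (j : ℕ) + 1 < g.natDegree,
      mulRoot g (b j) = α j • b j + b ⟨j + 1, h⟩ := by
    intro j h
    rw [hb, hb, mulRoot_mk, AdjoinRoot.smul_mk, ← map_add, hs, hs]
    congr 1
    rw [Finset.prod_range_succ, smul_eq_C_mul]
    have : α' j = α j := by simp [α']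
    rw [this]
    ring
  have hdiag : ∀ j : Fin g.natDegree, (j : ℕ) + 1 ≠ g.natDegree →
      LinearMap.toMatrix b b (mulRoot g) j j = α j := by
    intro j hj
    rw [LinearMap.toMatrix_apply, hstep j (by omega)]
    simp [Fin.ext_iff]
  refine ⟨b, fun i => ?_, fun i j hij hj hij' => ?_, fun i hi => ?_⟩
  · by_cases hi : (i : ℕ) + 1 = g.natDegree
    · -- the last diagonal entry is determined by the trace
      have h := hα
      rw [LinearMap.trace_eq_matrix_trace F b, Matrix.trace,
        ← Finset.add_sum_erase _ _ (Finset.mem_univ i),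
        ← Finset.add_sum_erase (f := fun i => Matrix.diag _ i) _ (Finset.mem_univ i)] at h
      have hrest : ∑ x ∈ Finset.univ.erase i, α x =
          ∑ x ∈ Finset.univ.erase i, (LinearMap.toMatrix b b (mulRoot g)).diag x :=
        Finset.sum_congr rfl fun j hj => (hdiag j fun hj' =>
          (Finset.mem_erase.1 hj).1 (Fin.ext (by omega))).symm
      rw [hrest] at h
      exact (add_right_cancel h).symm
    · exact hdiag i hi
  · rw [LinearMap.toMatrix_apply, hstep j (by omega)]
    have h1 : (⟨j + 1, by omega⟩ : Fin g.natDegree) ≠ i := fun h => hij' (by rw [← h])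
    simp [hij.symm, h1]
  · rw [hb, hs, hi]
    simp

/-- The Hessenberg basis, reordered: the first basis vector and the last `a + b - 1` ones are put in
front and divided alternately into two blocks, the remaining ones form a third block. Each block
contains no two neighbours, apart from the third one, so all three diagonal blocks are triangular;
the third one is lower triangular. -/
theorem exists_block_basis {g : F[X]} (hg : g.Monic) {a b k : ℕ} (hd : a + b + k = g.natDegree)
    (hb : 1 ≤ b) (hab : a = b ∨ a = b + 1) (β : (Fin a ⊕ Fin b) ⊕ Fin k → F)
    (hβ : ∑ i, β i = LinearMap.trace F _ (mulRoot g)) :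
    ∃ B : Module.Basis ((Fin a ⊕ Fin b) ⊕ Fin k) F (AdjoinRoot g),
      (∀ i, LinearMap.toMatrix B B (mulRoot g) i i = β i) ∧
      (∀ i j : Fin a, j < i →
        LinearMap.toMatrix B B (mulRoot g) (.inl (.inl i)) (.inl (.inl j)) = 0) ∧
      (∀ i j : Fin b, j < i →
        LinearMap.toMatrix B B (mulRoot g) (.inl (.inr i)) (.inl (.inr j)) = 0) ∧
      (∀ i j : Fin k, i < j →
        LinearMap.toMatrix B B (mulRoot g) (.inr i) (.inr j) = 0) ∧
      ∀ i : Fin a, (i : ℕ) = 0 → B (.inl (.inl i)) = 1 := by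
  -- the position in the Hessenberg basis of each vector of the reordered basis
  let pos : (Fin a ⊕ Fin b) ⊕ Fin k → Fin g.natDegree := fun x =>
    match x with
    | .inl (.inl i) => if (i : ℕ) = 0 then ⟨0, by omega⟩ else ⟨k + 2 * i, by omega⟩
    | .inl (.inr i) => ⟨k + 2 * i + 1, by omega⟩
    | .inr i => ⟨i + 1, by omega⟩
  have hpos₁ : ∀ i : Fin a, (pos (.inl (.inl i)) : ℕ) = if (i : ℕ) = 0 then 0 else k + 2 * i := by
    intro i
    change ((if (i : ℕ) = 0 then _ else _ : Fin g.natDegree) : ℕ) = _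
    split_ifs <;> rfl
  have hpos₂ : ∀ i : Fin b, (pos (.inl (.inr i)) : ℕ) = k + 2 * i + 1 := fun i => rfl
  have hpos₃ : ∀ i : Fin k, (pos (.inr i) : ℕ) = i + 1 := fun i => rfl
  clear_value pos
  have hinj : Function.Injective pos := by
    intro x y hxy
    have h := congrArg Fin.val hxy
    rcases x with (i | i) | i <;> rcases y with (j | j) | j <;>
      simp only [hpos₁, hpos₂, hpos₃] at h <;>
      simp only [Sum.inl.injEq, Sum.inr.injEq, Fin.ext_iff, reduceCtorEq] <;>
      (try split_ifs at h) <;> omega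
  have hbij : Function.Bijective pos :=
    (Fintype.bijective_iff_injective_and_card _).2 ⟨hinj, by simp [hd]⟩
  let e := Equiv.ofBijective pos hbij
  obtain ⟨B, hB₁, hB₂, hB₃⟩ := exists_hessenberg_basis hg (fun i => β (e.symm i))
    (by rw [← hβ]; exact Equiv.sum_comp e.symm β)
  have hmat : ∀ x y, LinearMap.toMatrix (B.reindex e.symm) (B.reindex e.symm) (mulRoot g) x y =
      LinearMap.toMatrix B B (mulRoot g) (pos x) (pos y) := by
    intro x y
    simp only [LinearMap.toMatrix_apply, Module.Basis.reindex_apply,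
      Module.Basis.repr_reindex_apply]
    rfl
  refine ⟨B.reindex e.symm, fun i => ?_, fun i j hij => ?_, fun i j hij => ?_, fun i j hij => ?_,
    fun i hi => ?_⟩
  · rw [hmat, hB₁]
    exact congrArg β (e.symm_apply_apply i)
  · rw [hmat]
    refine hB₂ _ _ (hinj.ne (by simpa using hij.ne')) ?_ ?_
    · rw [hpos₁]; split_ifs <;> omega
    · rw [hpos₁, hpos₁]; split_ifs <;> omega
  · rw [hmat]
    refine hB₂ _ _ (hinj.ne (by simpa using hij.ne')) ?_ ?_
    · rw [hpos₂]; omega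
    · rw [hpos₂, hpos₂]; omega
  · rw [hmat]
    refine hB₂ _ _ (hinj.ne (by simpa using hij.ne)) ?_ ?_
    · rw [hpos₃]; omega
    · rw [hpos₃, hpos₃]; omega
  · rw [Module.Basis.reindex_apply]
    refine hB₃ _ ?_
    change (pos (.inl (.inl i)) : ℕ) = 0
    rw [hpos₁, if_pos hi]

end Blocks

/-! ### Spectral decompositions -/

section Spectral

variable {F : Type u} [Field F]
variable {V W Z U : Type u} [AddCommGroup V] [Module F V] [AddCommGroup W] [Module F W]
  [AddCommGroup Z] [Module F Z] [AddCommGroup U] [Module F U]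

theorem aeval_X_sub_C_pow (f : Module.End F V) (c : F) (m : ℕ) :
    aeval f ((X - C c) ^ m) = (f - c • 1) ^ m := by
  rw [map_pow, map_sub, aeval_X, aeval_C, Algebra.algebraMap_eq_smul_one]

theorem aeval_apply_of_intertwine {f : Module.End F V} {g : Module.End F W} (T : V →ₗ[F] W)
    (h : ∀ v, T (f v) = g (T v)) (p : F[X]) (v : V) : T (aeval f p v) = aeval g p (T v) := by
  induction p using Polynomial.induction_on' generalizing v with
  | add p q hp hq => simp [hp, hq]
  | monomial n a =>
    have hpow : ∀ n v, T ((f ^ n) v) = (g ^ n) (T v) := by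
      intro n
      induction n with
      | zero => simp
      | succ n ih => intro v; rw [pow_succ, pow_succ, Module.End.mul_apply, ih, h]; rfl
    rw [aeval_monomial, aeval_monomial]
    simp [hpow, Module.algebraMap_end_apply]

/-- If `f` acts on a subspace through `g` and on the quotient through `h`, then annihilating
polynomials of `h` and `g` multiply to one of `f`. -/
theorem aeval_mul_eq_zero_of_exact {f : Module.End F V} {g : Module.End F W} {h : Module.End F U}
    (i : W →ₗ[F] V) (π : V →ₗ[F] U) (hi : ∀ w, i (g w) = f (i w)) (hπ : ∀ v, π (f v) = h (π v))
    (hex : ∀ v, π v = 0 → ∃ w, i w = v) {p q : F[X]} (hp : aeval h p = 0) (hq : aeval g q = 0) :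
    aeval f (p * q) = 0 := by
  ext v
  rw [mul_comm, map_mul, Module.End.mul_apply]
  obtain ⟨w, hw⟩ := hex (aeval f p v) (by rw [aeval_apply_of_intertwine π hπ, hp]; rfl)
  rw [← hw, ← aeval_apply_of_intertwine i hi, hq]
  exact map_zero i

theorem charpoly_eq_of_pow_eq_zero [FiniteDimensional F V] {f : Module.End F V} {c : F} {m : ℕ}
    (h : (f - c • 1) ^ m = 0) : f.charpoly = (X - C c) ^ Module.finrank F V := by
  have h1 := IsNilpotent.charpoly_eq_X_pow_finrank (R := F) (φ := f - c • 1) ⟨m, h⟩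
  rw [LinearMap.charpoly_sub_smul] at h1
  have h2 := congrArg (fun p => p.comp (X - C c)) h1
  simpa [comp_assoc] using h2

/-- Splitting off a generalized eigenspace. -/
theorem exists_sim_prod_of_aeval_eq_zero [FiniteDimensional F V] {f : Module.End F V} {c : F}
    {m n : ℕ} {q r : F[X]} (hf : aeval f ((X - C c) ^ m * q) = 0) (hq : q.eval c ≠ 0)
    (hχ : f.charpoly = (X - C c) ^ n * r) (hr : r.eval c ≠ 0) :
    ∃ (W : Type u) (_ : AddCommGroup W) (_ : Module F W) (_ : FiniteDimensional F W)
      (g : Module.End F W) (U : Type u) (_ : AddCommGroup U) (_ : Module F U)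
      (_ : FiniteDimensional F U) (h : Module.End F U), Sim f (g.prodMap h) ∧
      Module.finrank F W = n ∧ (g - c • 1) ^ m = 0 ∧ aeval h q = 0 ∧ h.charpoly = r := by
  have hcop : IsCoprime ((X - C c) ^ m) q := by
    refine IsCoprime.pow_left ((irreducible_X_sub_C c).coprime_iff_not_dvd.2 ?_)
    rwa [dvd_iff_isRoot]
  have hcompl : IsCompl (LinearMap.ker (aeval f ((X - C c) ^ m))) (LinearMap.ker (aeval f q)) := by
    refine ⟨disjoint_ker_aeval_of_isCoprime f hcop, ?_⟩
    rw [codisjoint_iff, sup_ker_aeval_eq_ker_aeval_mul_of_coprime f hcop, hf, LinearMap.ker_zero]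
  have hinv : ∀ p : F[X], ∀ v ∈ LinearMap.ker (aeval f p), f v ∈ LinearMap.ker (aeval f p) := by
    intro p v hv
    rw [LinearMap.mem_ker] at hv ⊢
    rw [← aeval_apply_of_intertwine f (fun _ => rfl), hv, map_zero]
  let g := f.restrict (hinv ((X - C c) ^ m))
  let h := f.restrict (hinv q)
  have hann : ∀ p : F[X], aeval (f.restrict (hinv p)) p = 0 := by
    intro p
    ext v
    have := aeval_apply_of_intertwine (f := f.restrict (hinv p)) (g := f)
      (Submodule.subtype _) (fun _ => rfl) p v
    rw [Submodule.subtype_apply] at this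
    rw [this]
    exact v.2
  have hs : Sim f (g.prodMap h) := by
    refine Sim.symm ⟨Submodule.prodEquivOfIsCompl _ _ hcompl, fun v => ?_⟩
    have hcoe : ∀ v, Submodule.prodEquivOfIsCompl _ _ hcompl v = (v.1 : V) + v.2 := fun v => rfl
    rw [hcoe, hcoe, map_add]
    rfl
  have hg : (g - c • 1) ^ m = 0 := by
    exact (aeval_X_sub_C_pow g c m).symm.trans (hann _)
  have hχ' : f.charpoly = (X - C c) ^ Module.finrank F (LinearMap.ker (aeval f ((X - C c) ^ m))) *
      h.charpoly := by
    obtain ⟨e, he⟩ := hs.exists_conj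
    rw [← LinearEquiv.charpoly_conj e f, he, LinearMap.charpoly_prodMap,
      charpoly_eq_of_pow_eq_zero hg]
  have hh : h.charpoly.eval c ≠ 0 := by
    intro h0
    have hev : Module.End.HasEigenvalue h c :=
      (Module.End.hasEigenvalue_iff_isRoot_charpoly h c).2 h0
    obtain ⟨v, hv⟩ := hev.exists_hasEigenvector
    have h1 := Module.End.aeval_apply_of_hasEigenvector (p := q) hv
    rw [hann q] at h1
    exact (smul_ne_zero hq hv.2) h1.symm
  have hrank : Module.finrank F (LinearMap.ker (aeval f ((X - C c) ^ m))) = n := by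
    have h1 := congrArg (rootMultiplicity c) (hχ'.symm.trans hχ)
    have aux : ∀ (k : ℕ) (s : F[X]), s.eval c ≠ 0 →
        rootMultiplicity c ((X - C c) ^ k * s) = k := by
      intro k s hs
      have hs0 : s ≠ 0 := fun h => hs (by rw [h, eval_zero])
      rw [rootMultiplicity_mul (mul_ne_zero (pow_ne_zero _ (X_sub_C_ne_zero c)) hs0),
        rootMultiplicity_X_sub_C_pow, rootMultiplicity_eq_zero hs, add_zero]
    rwa [aux _ _ hh, aux _ _ hr] at h1
  refine ⟨_, _, _, inferInstance, g, _, _, _, inferInstance, h, hs, hrank, hg, hann q, ?_⟩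
  rw [hrank, hχ] at hχ'
  exact (mul_left_cancel₀ (pow_ne_zero _ (X_sub_C_ne_zero c)) hχ').symm

/-- The spectral decomposition of an endomorphism with simple eigenvalues `y` and `-z`, with
eigenvalue `-c` without Jordan blocks of size greater than two, and no other nonzero eigenvalue. -/
theorem exists_sim_of_charpoly [FiniteDimensional F V] {f : Module.End F V} {y z c : F} {e k N : ℕ}
    (hy : y ≠ 0) (hz : z ≠ 0) (hc : c ≠ 0) (hyz : y ≠ -z) (hyc : y ≠ -c) (hzc : z ≠ c)
    (hχ : f.charpoly = (X - C y) * ((X - C (-z)) * ((X - C (-c)) ^ e * X ^ k)))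
    (hf : aeval f ((X - C y) * ((X - C (-z)) * ((X - C (-c)) ^ 2 * X ^ N))) = 0) :
    ∃ (W : Type u) (_ : AddCommGroup W) (_ : Module F W) (_ : FiniteDimensional F W)
      (G : Module.End F W) (U : Type u) (_ : AddCommGroup U) (_ : Module F U)
      (K : Module.End F U), OddEnd K ∧ Module.finrank F W = e ∧ (G + c • 1) ^ 2 = 0 ∧
      Sim f ((y • (1 : Module.End F F)).prodMap (((-z) • (1 : Module.End F F)).prodMap
        (G.prodMap K))) := by
  have hzy : -z ≠ y := hyz.symm
  have hcz : -z ≠ -c := fun h => hzc (neg_injective h)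
  have nz : ∀ {a b : F}, a ≠ b → a - b ≠ 0 := fun h => sub_ne_zero.2 h
  rw [← pow_one (X - C y)] at hχ hf
  obtain ⟨W₁, _, _, _, g₁, U₁, _, _, _, h₁, hs₁, hr₁, hg₁, hq₁, hχ₁⟩ :=
    exists_sim_prod_of_aeval_eq_zero hf (by
      simp only [eval_mul, eval_sub, eval_X, eval_C, eval_pow]
      exact mul_ne_zero (nz hyz) (mul_ne_zero (pow_ne_zero _ (nz hyc)) (pow_ne_zero _ hy))) hχ (by
      simp only [eval_mul, eval_sub, eval_X, eval_C, eval_pow]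
      exact mul_ne_zero (nz hyz) (mul_ne_zero (pow_ne_zero _ (nz hyc)) (pow_ne_zero _ hy)))
  rw [← pow_one (X - C (-z))] at hχ₁ hq₁
  obtain ⟨W₂, _, _, _, g₂, U₂, _, _, _, h₂, hs₂, hr₂, hg₂, hq₂, hχ₂⟩ :=
    exists_sim_prod_of_aeval_eq_zero hq₁ (by
      simp only [eval_mul, eval_sub, eval_X, eval_C, eval_pow]
      exact mul_ne_zero (pow_ne_zero _ (nz hcz)) (pow_ne_zero _ (neg_ne_zero.2 hz))) hχ₁ (by
      simp only [eval_mul, eval_sub, eval_X, eval_C, eval_pow]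
      exact mul_ne_zero (pow_ne_zero _ (nz hcz)) (pow_ne_zero _ (neg_ne_zero.2 hz)))
  obtain ⟨W₃, _, _, hW₃, g₃, U₃, _, _, _, h₃, hs₃, hr₃, hg₃, hq₃, -⟩ :=
    exists_sim_prod_of_aeval_eq_zero hq₂ (by
      simp only [eval_pow, eval_X]
      exact pow_ne_zero _ (neg_ne_zero.2 hc)) hχ₂ (by
      simp only [eval_pow, eval_X]
      exact pow_ne_zero _ (neg_ne_zero.2 hc))
  rw [pow_one, sub_eq_zero] at hg₁ hg₂
  rw [neg_smul, sub_neg_eq_add] at hg₃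
  have hnil : IsNilpotent h₃ := ⟨N, by rwa [map_pow, aeval_X] at hq₃⟩
  refine ⟨W₃, _, _, hW₃, g₃, U₃, _, _, h₃, OddEnd.of_isNilpotent hnil, hr₃, hg₃, hs₁.trans ?_⟩
  rw [hg₁]
  refine (Sim.smul_one y (by rw [hr₁, Module.finrank_self])).prod (hs₂.trans ?_)
  rw [hg₂]
  exact (Sim.smul_one (-z) (by rw [hr₂, Module.finrank_self])).prod hs₃

theorem charpoly_lowerBlock [FiniteDimensional F W] [FiniteDimensional F Z] (f : Module.End F W)
    (R : W →ₗ[F] Z) (g : Module.End F Z) :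
    (lowerBlock f R g).charpoly = f.charpoly * g.charpoly := by
  let b := Module.finBasis F W
  let b' := Module.finBasis F Z
  have : LinearMap.toMatrix (b.prod b') (b.prod b') (lowerBlock f R g) =
      Matrix.fromBlocks (LinearMap.toMatrix b b f) 0 (LinearMap.toMatrix b b' R)
        (LinearMap.toMatrix b' b' g) := by
    ext (i | i) (j | j) <;> simp [LinearMap.toMatrix_apply, lowerBlock_apply]
  rw [← LinearMap.charpoly_toMatrix _ (b.prod b'), this, Matrix.charpoly_fromBlocks_zero₁₂,
    LinearMap.charpoly_toMatrix, LinearMap.charpoly_toMatrix]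

theorem aeval_lowerBlock_eq_zero {f : Module.End F W} (R : W →ₗ[F] Z) {g : Module.End F Z}
    {p q : F[X]} (hp : aeval f p = 0) (hq : aeval g q = 0) :
    aeval (lowerBlock f R g) (p * q) = 0 :=
  aeval_mul_eq_zero_of_exact (LinearMap.inr F W Z) (LinearMap.fst F W Z)
    (fun z => by simp [lowerBlock_apply]) (fun v => rfl)
    (fun v hv => ⟨v.2, Prod.ext hv.symm rfl⟩) hp hq

end Spectral

/-! ### Prescribing the spectrum of a block triangular endomorphism -/

section BlockMatrices

variable {F : Type u} [Field F]
variable {m n : Type*} [Fintype m] [Fintype n] [DecidableEq m] [DecidableEq n]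

/-- Annihilating polynomials of the diagonal blocks of a block triangular matrix multiply to one of
the matrix. -/
theorem aeval_fromBlocks_zero₁₂ {A : Matrix m m F} (B : Matrix n m F) {D : Matrix n n F}
    {p q : F[X]} (hp : aeval A p = 0) (hq : aeval D q = 0) :
    aeval (Matrix.fromBlocks A 0 B D) (p * q) = 0 := by
  have key : ∀ r : F[X], ∃ Y, aeval (Matrix.fromBlocks A 0 B D) r =
      Matrix.fromBlocks (aeval A r) 0 Y (aeval D r) := by
    intro r
    induction r using Polynomial.induction_on with
    | C a =>
      refine ⟨0, ?_⟩
      simp only [aeval_C, Algebra.algebraMap_eq_smul_one, ← Matrix.fromBlocks_one,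
        Matrix.fromBlocks_smul, smul_zero]
    | add r s hr hs =>
      obtain ⟨Y, hY⟩ := hr
      obtain ⟨Y', hY'⟩ := hs
      exact ⟨Y + Y', by simp only [map_add, hY, hY', Matrix.fromBlocks_add, add_zero]⟩
    | monomial k a h =>
      obtain ⟨Y, hY⟩ := h
      refine ⟨Y * A + aeval D (C a * X ^ k) * B, ?_⟩
      rw [pow_succ, ← mul_assoc, map_mul _ _ X, hY, aeval_X, Matrix.fromBlocks_multiply,
        map_mul (aeval A) _ X, map_mul (aeval D) _ X, aeval_X, aeval_X]
      simp only [Matrix.zero_mul, Matrix.mul_zero, add_zero, zero_add]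
  obtain ⟨Y, hY⟩ := key p
  obtain ⟨Y', hY'⟩ := key q
  rw [mul_comm, map_mul, hY, hY', hp, hq, Matrix.fromBlocks_multiply]
  simp

theorem aeval_fromBlocks_zero₂₁ {A : Matrix m m F} (B : Matrix m n F) {D : Matrix n n F}
    {p q : F[X]} (hp : aeval A p = 0) (hq : aeval D q = 0) :
    aeval (Matrix.fromBlocks A B 0 D) (p * q) = 0 := by
  have key : ∀ r : F[X], ∃ Y, aeval (Matrix.fromBlocks A B 0 D) r =
      Matrix.fromBlocks (aeval A r) Y 0 (aeval D r) := by
    intro r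
    induction r using Polynomial.induction_on with
    | C a =>
      refine ⟨0, ?_⟩
      simp only [aeval_C, Algebra.algebraMap_eq_smul_one, ← Matrix.fromBlocks_one,
        Matrix.fromBlocks_smul, smul_zero]
    | add r s hr hs =>
      obtain ⟨Y, hY⟩ := hr
      obtain ⟨Y', hY'⟩ := hs
      exact ⟨Y + Y', by simp only [map_add, hY, hY', Matrix.fromBlocks_add, add_zero]⟩
    | monomial k a h =>
      obtain ⟨Y, hY⟩ := h
      refine ⟨aeval A (C a * X ^ k) * B + Y * D, ?_⟩
      rw [pow_succ, ← mul_assoc, map_mul _ _ X, hY, aeval_X, Matrix.fromBlocks_multiply,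
        map_mul (aeval A) _ X, map_mul (aeval D) _ X, aeval_X, aeval_X]
      simp only [Matrix.zero_mul, Matrix.mul_zero, add_zero, zero_add]
  obtain ⟨Y, hY⟩ := key p
  obtain ⟨Y', hY'⟩ := key q
  rw [map_mul, hY, hY', hp, hq, Matrix.fromBlocks_multiply]
  simp

theorem prod_X_sub_C_ite (n k : ℕ) (hk : k ≤ n) (c : F) :
    ∏ i : Fin n, (X - C (if (i : ℕ) < k then c else 0)) = (X - C c) ^ k * X ^ (n - k) := by
  obtain ⟨l, rfl⟩ := Nat.exists_eq_add_of_le hk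
  rw [Fin.prod_univ_add]
  simp

theorem sum_ite_lt (n k : ℕ) (hk : k ≤ n) (c : F) :
    ∑ i : Fin n, (if (i : ℕ) < k then c else 0) = k * c := by
  obtain ⟨l, rfl⟩ := Nat.exists_eq_add_of_le hk
  rw [Fin.sum_univ_add]
  simp

theorem charpoly_diagonal_ite (n k : ℕ) (hk : k ≤ n) (c : F) :
    (Matrix.diagonal fun i : Fin n => if (i : ℕ) < k then c else 0).charpoly =
      (X - C c) ^ k * X ^ (n - k) := by
  rw [Matrix.charpoly_diagonal, prod_X_sub_C_ite n k hk]

theorem aeval_diagonal_ite (n k : ℕ) (c : F) :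
    aeval (Matrix.diagonal fun i : Fin n => if (i : ℕ) < k then c else 0) ((X - C c) * X) = 0 := by
  simp only [map_mul, map_sub, aeval_X, aeval_C, Algebra.algebraMap_eq_smul_one,
    Matrix.smul_one_eq_diagonal, Matrix.diagonal_sub, Matrix.diagonal_mul_diagonal]
  rw [← Matrix.diagonal_zero]
  congr 1
  ext i
  split_ifs <;> simp

theorem charpoly_of_upper {n : ℕ} {M : Matrix (Fin n) (Fin n) F} (hM : ∀ i j, j < i → M i j = 0)
    {k : ℕ} (hk : k ≤ n) {c : F} (hd : ∀ i, M i i = if (i : ℕ) < k then c else 0) :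
    M.charpoly = (X - C c) ^ k * X ^ (n - k) := by
  rw [Matrix.charpoly_of_isUpperTriangular M (fun i j h => hM i j h), ← prod_X_sub_C_ite n k hk]
  exact Finset.prod_congr rfl fun i _ => by rw [hd]

end BlockMatrices

section Absorb

variable {F : Type u} [Field F]

/-- The spectrum obtained by subtracting a square-zero endomorphism from the block triangular
endomorphism `[[c, 0], [R, g]]`, where `c` acts on a space of dimension `a + b`. In a basis as in
`exists_block_basis` the map `R` is the inclusion of the first two blocks. The corner `c` is traded
for an arbitrary matrix `P`, at the price of replacing the block `M₁₁` of `g` by `M₁₁ + c - P`. Both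
are chosen block triangular with triangular diagonal blocks,
`P = [[π, 0], [*, * - τ]]` and `M₁₁ + c - P = [[* - π, *], [0, τ]]`, where `π` and `τ` are diagonal
with entries `-c` (`a'` and `b'` times) and `0`, and the diagonal of the Hessenberg matrix is such
that the other two blocks have the spectra `y, 0, …, 0` and `-z, 0, …, 0`. Since `π` and `τ` are
diagonal, the Jordan blocks for `-c` have size at most two. -/
theorem exists_sub_sim_lowerBlock_of_trace {g : F[X]} [FiniteDimensional F (AdjoinRoot g)]
    (hg : g.Monic) {a b k a' b' : ℕ}
    (hd : a + b + k = g.natDegree) (hb : 1 ≤ b) (hab : a = b ∨ a = b + 1) (ha' : a' ≤ a)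
    (hb' : b' ≤ b) (c y z : F)
    (htr : LinearMap.trace F _ (mulRoot g) = y - z - (a + b + a' + b' : ℕ) * c) (i₀ : Fin a)
    (hi₀ : (i₀ : ℕ) = 0) :
    ∃ R : (Fin a ⊕ Fin b → F) →ₗ[F] AdjoinRoot g, R (Pi.single (.inl i₀) 1) = 1 ∧
      ∃ S f : Module.End F ((Fin a ⊕ Fin b → F) × AdjoinRoot g), S * S = 0 ∧
        Sim (lowerBlock (c • 1) R (mulRoot g) - S) f ∧
        f.charpoly = (X - C y) * ((X - C (-z)) * ((X - C (-c)) ^ (a' + b') *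
          X ^ (a - a' + (b - b') + (a - 1) + (b - 1) + k))) ∧
        aeval f ((X - C y) * ((X - C (-z)) * ((X - C (-c)) ^ 2 * X ^ (a + b + k)))) = 0 := by
  let π : Fin a → F := fun i => if (i : ℕ) < a' then -c else 0
  let τ : Fin b → F := fun i => if (i : ℕ) < b' then -c else 0
  obtain ⟨B, hBd, hBe, hBo, hBk, hB1⟩ := exists_block_basis hg hd hb hab
    (Sum.elim (Sum.elim (fun i => π i - c + if (i : ℕ) < 1 then -z else 0)
      (fun i => τ i - c + if (i : ℕ) < 1 then y else 0)) fun _ => 0) (by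
      rw [htr]
      simp only [Fintype.sum_sum_type, Sum.elim_inl, Sum.elim_inr, Finset.sum_add_distrib,
        Finset.sum_sub_distrib, π, τ, sum_ite_lt a a' ha', sum_ite_lt b b' hb',
        sum_ite_lt a 1 (by omega), sum_ite_lt b 1 hb]
      simp
      ring)
  set M := LinearMap.toMatrix B B (mulRoot g) with hM
  let P : Matrix (Fin a ⊕ Fin b) (Fin a ⊕ Fin b) F :=
    Matrix.fromBlocks (Matrix.diagonal π) 0 M.toBlocks₁₁.toBlocks₂₁
      (M.toBlocks₁₁.toBlocks₂₂ + c • 1 - Matrix.diagonal τ)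
  let T₁ : Matrix (Fin a ⊕ Fin b) (Fin a ⊕ Fin b) F :=
    Matrix.fromBlocks (M.toBlocks₁₁.toBlocks₁₁ + c • 1 - Matrix.diagonal π)
      M.toBlocks₁₁.toBlocks₁₂ 0 (Matrix.diagonal τ)
  let T : Matrix ((Fin a ⊕ Fin b) ⊕ Fin k) ((Fin a ⊕ Fin b) ⊕ Fin k) F :=
    Matrix.fromBlocks T₁ 0 M.toBlocks₂₁ M.toBlocks₂₂
  have hPT : M.toBlocks₁₁ + c • 1 = P + T₁ := by
    have h : M.toBlocks₁₁ + c • 1 = Matrix.fromBlocks M.toBlocks₁₁.toBlocks₁₁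
        M.toBlocks₁₁.toBlocks₁₂ M.toBlocks₁₁.toBlocks₂₁ M.toBlocks₁₁.toBlocks₂₂ +
        c • Matrix.fromBlocks 1 0 0 1 := by
      rw [Matrix.fromBlocks_toBlocks, Matrix.fromBlocks_one]
    rw [h]
    simp only [P, T₁, Matrix.fromBlocks_smul, Matrix.fromBlocks_add, smul_zero, add_zero, zero_add,
      sub_add_cancel, add_sub_cancel]
  have hχe : (M.toBlocks₁₁.toBlocks₁₁ + c • 1 - Matrix.diagonal π).charpoly =
      (X - C (-z)) ^ 1 * X ^ (a - 1) := by
    refine charpoly_of_upper (fun i j hij => ?_) (by omega) fun i => ?_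
    · simp [hBe i j hij, Matrix.one_apply_ne hij.ne', Matrix.diagonal_apply_ne _ hij.ne',
        Matrix.toBlocks₁₁]
    · simp [Matrix.toBlocks₁₁, hBd]
      ring
  have hχo : (M.toBlocks₁₁.toBlocks₂₂ + c • 1 - Matrix.diagonal τ).charpoly =
      (X - C y) ^ 1 * X ^ (b - 1) := by
    refine charpoly_of_upper (fun i j hij => ?_) (by omega) fun i => ?_
    · simp [hBo i j hij, Matrix.one_apply_ne hij.ne', Matrix.diagonal_apply_ne _ hij.ne',
        Matrix.toBlocks₁₁, Matrix.toBlocks₂₂]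
    · simp [Matrix.toBlocks₁₁, Matrix.toBlocks₂₂, hBd]
      ring
  have hχk : M.toBlocks₂₂.charpoly = X ^ k := by
    rw [← Matrix.charpoly_transpose, charpoly_of_upper (k := 0) (c := 0)
      (fun i j hij => ?_) (by omega) fun i => ?_]
    · simp
    · exact hBk j i hij
    · simp [Matrix.toBlocks₂₂, hBd]
  have hCH : ∀ {n : ℕ} {N : Matrix (Fin n) (Fin n) F} {p : F[X]}, N.charpoly = p →
      aeval N p = 0 := fun h => h ▸ Matrix.aeval_self_charpoly _
  have hχP : P.charpoly = (X - C (-c)) ^ a' * X ^ (a - a') * ((X - C y) ^ 1 * X ^ (b - 1)) := by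
    rw [Matrix.charpoly_fromBlocks_zero₁₂, hχo, charpoly_diagonal_ite a a' ha']
  have hχT : T.charpoly = (X - C (-z)) ^ 1 * X ^ (a - 1) *
      ((X - C (-c)) ^ b' * X ^ (b - b')) * X ^ k := by
    rw [Matrix.charpoly_fromBlocks_zero₁₂, Matrix.charpoly_fromBlocks_zero₂₁, hχe, hχk,
      charpoly_diagonal_ite b b' hb']
  have hP : aeval P ((X - C (-c)) * X * ((X - C y) ^ 1 * X ^ (b - 1))) = 0 :=
    aeval_fromBlocks_zero₁₂ _ (aeval_diagonal_ite a a' (-c)) (hCH hχo)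
  have hT : aeval T ((X - C (-z)) ^ 1 * X ^ (a - 1) * ((X - C (-c)) * X) * X ^ k) = 0 :=
    aeval_fromBlocks_zero₁₂ _ (aeval_fromBlocks_zero₂₁ _ (hCH hχe) (aeval_diagonal_ite b b' (-c)))
      (hCH hχk)
  let R : (Fin a ⊕ Fin b → F) →ₗ[F] AdjoinRoot g :=
    Matrix.toLin (Pi.basisFun F _) B (Matrix.fromRows 1 0)
  let Q : AdjoinRoot g →ₗ[F] (Fin a ⊕ Fin b → F) :=
    Matrix.toLin B (Pi.basisFun F _) (Matrix.fromCols (P - c • 1) M.toBlocks₁₂)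
  have hQR : c • 1 + Q ∘ₗ R = Matrix.toLin' P := by
    rw [← Matrix.toLin_mul, Matrix.fromCols_mul_fromRows, Matrix.toLin_eq_toLin']
    simp [Module.End.one_eq_id]
  have hRQ : LinearMap.toMatrixAlgEquiv B (mulRoot g - R ∘ₗ Q) = T := by
    have h1 : R ∘ₗ Q = Matrix.toLin B B (Matrix.fromBlocks (P - c • 1) M.toBlocks₁₂ 0 0) := by
      rw [← Matrix.toLin_mul, Matrix.fromRows_mul_fromCols]
      simp
    rw [h1, map_sub]
    change M - LinearMap.toMatrix B B _ = _
    rw [LinearMap.toMatrix_toLin]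
    rw [sub_eq_iff_eq_add, Matrix.fromBlocks_add, add_sub, add_comm T₁, ← hPT, zero_add, add_zero,
      add_zero, add_sub_cancel_right, Matrix.fromBlocks_toBlocks]
  obtain ⟨S, hS, hsim⟩ := exists_sub_sim_lowerBlock (c • 1) R (mulRoot g) Q
  rw [hQR] at hsim
  refine ⟨R, ?_, S, _, hS, hsim, ?_, ?_⟩
  · rw [← hB1 i₀ hi₀, ← Pi.basisFun_apply, Matrix.toLin_self]
    simp [Matrix.one_apply]
  · rw [charpoly_lowerBlock, ← LinearMap.charpoly_toMatrix (mulRoot g - R ∘ₗ Q) B,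
      Matrix.charpoly_toLin']
    change P.charpoly * (LinearMap.toMatrixAlgEquiv B (mulRoot g - R ∘ₗ Q)).charpoly = _
    rw [hRQ, hχP, hχT]
    ring
  · have hP' : aeval (Matrix.toLin' P) ((X - C (-c)) * X * ((X - C y) ^ 1 * X ^ (b - 1))) = 0 := by
      change aeval (Matrix.toLinAlgEquiv' P) _ = 0
      rw [← AlgEquiv.coe_toAlgHom, aeval_algHom_apply, hP, map_zero]
    have hT' : aeval (mulRoot g - R ∘ₗ Q)
        ((X - C (-z)) ^ 1 * X ^ (a - 1) * ((X - C (-c)) * X) * X ^ k) = 0 := by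
      apply (LinearMap.toMatrixAlgEquiv B).injective
      rw [map_zero, ← AlgEquiv.coe_toAlgHom, ← aeval_algHom_apply, AlgEquiv.coe_toAlgHom, hRQ, hT]
    have h := aeval_lowerBlock_eq_zero R hP' hT'
    convert h using 2
    obtain ⟨b, rfl⟩ := Nat.exists_eq_add_of_le hb
    obtain ⟨a, rfl⟩ := Nat.exists_eq_add_of_le (show 1 ≤ a by omega)
    simp only [Nat.add_sub_cancel_left]
    ring

end Absorb

/-! ### Absorption of one-dimensional summands by a cyclic summand -/

section Modulo

variable {F : Type u} [Field F]
variable {V W U V' W' : Type u} [AddCommGroup V] [Module F V] [AddCommGroup W] [Module F W]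
  [AddCommGroup U] [Module F U] [AddCommGroup V'] [Module F V'] [AddCommGroup W'] [Module F W']

/-- `f` is similar to `g` after subtraction of a square-zero endomorphism. This relation is not
transitive; it can be composed with similarities on both sides. -/
def SimModSquareZero (f : Module.End F V) (g : Module.End F W) : Prop :=
  ∃ S : Module.End F V, S * S = 0 ∧ Sim (f - S) g

theorem Sim.modSquareZero {f : Module.End F V} {g : Module.End F W} (h : Sim f g) :
    SimModSquareZero f g :=
  ⟨0, mul_zero 0, by rwa [sub_zero]⟩

theorem SimModSquareZero.trans_sim {f : Module.End F V} {g : Module.End F W} {h : Module.End F U}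
    (h₁ : SimModSquareZero f g) (h₂ : Sim g h) : SimModSquareZero f h := by
  obtain ⟨S, hS, hs⟩ := h₁
  exact ⟨S, hS, hs.trans h₂⟩

theorem Sim.trans_modSquareZero {f : Module.End F V} {g : Module.End F W} {h : Module.End F U}
    (h₁ : Sim f g) (h₂ : SimModSquareZero g h) : SimModSquareZero f h := by
  obtain ⟨S, hS, hs⟩ := h₂
  obtain ⟨e, rfl⟩ := h₁.symm.exists_conj
  refine ⟨e.conj S, by rw [← conj_mul', hS, map_zero], ?_⟩
  rw [← map_sub]
  exact (Sim.conj e).symm.trans hs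

theorem SimModSquareZero.prod {f : Module.End F V} {g : Module.End F W} {f' : Module.End F V'}
    {g' : Module.End F W'} (h : SimModSquareZero f f') (h' : SimModSquareZero g g') :
    SimModSquareZero (f.prodMap g) (f'.prodMap g') := by
  obtain ⟨S, hS, hs⟩ := h
  obtain ⟨S', hS', hs'⟩ := h'
  refine ⟨S.prodMap S', by rw [LinearMap.prodMap_mul, hS, hS', LinearMap.prodMap_zero], ?_⟩
  have : f.prodMap g - S.prodMap S' = (f - S).prodMap (g - S') := by ext <;> simp
  rw [this]
  exact hs.prod hs'

theorem SimModSquareZero.oddModSquareZero {f : Module.End F V} {g : Module.End F W}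
    (h : SimModSquareZero f g) (hg : OddEnd g) : OddModSquareZero f := by
  obtain ⟨S, hS, hs⟩ := h
  exact ⟨S, hS, hg.of_sim hs⟩

theorem simModSquareZero_of_sub_mul_self {f g : Module.End F V} (h : (f - g) * (f - g) = 0) :
    SimModSquareZero f g :=
  ⟨f - g, h, by rw [sub_sub_cancel]; exact Sim.refl g⟩

/-- A scalar `c` can be traded for `-G` if `G` has no eigenvalue other than `-c` and Jordan blocks
of size at most two. -/
theorem simModSquareZero_smul_one_neg [FiniteDimensional F V] [FiniteDimensional F W] {c : F}
    {G : Module.End F W} (hG : (G + c • 1) ^ 2 = 0)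
    (h : Module.finrank F V = Module.finrank F W) :
    SimModSquareZero (c • (1 : Module.End F V)) (-G) := by
  refine (Sim.smul_one c h).trans_modSquareZero (simModSquareZero_of_sub_mul_self ?_)
  rw [sub_neg_eq_add, add_comm, ← pow_two, hG]

theorem Sim.prod_smul_one [FiniteDimensional F U] [FiniteDimensional F V'] [FiniteDimensional F W']
    {f : Module.End F V} {g : Module.End F W} {c : F}
    (h : Sim f (g.prodMap (c • (1 : Module.End F U))))
    (hr : Module.finrank F V' = Module.finrank F U + Module.finrank F W') :
    Sim (g.prodMap (c • (1 : Module.End F V'))) (f.prodMap (c • (1 : Module.End F W'))) := by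
  have h₁ : Sim (c • (1 : Module.End F V'))
      ((c • (1 : Module.End F U)).prodMap (c • (1 : Module.End F W'))) := by
    rw [smul_one_prodMap]
    exact Sim.smul_one c (by rw [hr, Module.finrank_prod])
  have h₂ := (Sim.refl g).prod h₁
  have h₃ := h₂.trans (Sim.prodAssoc _ _ _).symm
  exact h₃.trans (h.symm.prod (Sim.refl (c • (1 : Module.End F W'))))

theorem hasEnds_of_sim_prod_neg {f : Module.End F V} {G : Module.End F W} {K : Module.End F U}
    {y z : F} (hK : OddEnd K)
    (h : Sim f (((y • (1 : Module.End F F)).prodMap (((-z) • (1 : Module.End F F)).prodMap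
      (G.prodMap K))).prodMap (-G))) : HasEnds f y z := by
  refine ⟨_, _, _, _, (OddEnd.prod_neg G).prod hK, h.trans ?_⟩
  refine (Sim.prodAssoc _ _ _).trans ((Sim.refl _).prod ?_)
  refine (Sim.prodAssoc _ _ _).trans ((Sim.refl _).prod ?_)
  refine (Sim.prodAssoc _ _ _).trans ?_
  exact ((Sim.refl _).prod (Sim.prodComm _ _)).trans (Sim.prodAssoc _ _ _).symm

/-- The cyclic endomorphism with polynomial `(X - c) g` absorbs up to `2 deg g - 1` one-dimensional
summands `c`. Together with the direct summand `c` of dimension `a + b - 1` it is a block triangular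
endomorphism to which `exists_sub_sim_lowerBlock_of_trace` applies; up to `deg g` further copies
of `c` are matched with the eigenvalue `-c` produced there. -/
theorem linkable_mulRoot_prod [NeZero (2 : F)] {g : F[X]} (hg : g.Monic) {c : F} (hc : c ≠ 0)
    (hd : 2 ≤ g.natDegree) {t : ℕ} (ht : 1 ≤ t) (htd : t + 1 ≤ 2 * g.natDegree) :
    Linkable ((mulRoot ((X - C c) * g)).prodMap (c • (1 : Module.End F (Fin t → F)))) := by
  classical
  have := finiteDimensional_adjoinRoot hg
  have := finiteDimensional_adjoinRoot ((monic_X_sub_C c).mul hg)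
  -- `a + b - 1` copies of `c` enter the triangular endomorphism, `a' + b'` are matched with `-c`
  obtain ⟨a, b, k, a', b', hk, hb, hab, ha', hb', hsum⟩ : ∃ a b k a' b' : ℕ,
      a + b + k = g.natDegree ∧ 1 ≤ b ∧ (a = b ∨ a = b + 1) ∧ a' ≤ a ∧ b' ≤ b ∧
        a + b + a' + b' = t + 1 := by
    rcases le_total (t + 1) g.natDegree with h | h
    · exact ⟨(t + 2) / 2, (t + 1) / 2, g.natDegree - (t + 1), 0, 0, by omega, by omega, by omega,
        by omega, by omega, by omega⟩
    · obtain ⟨e, he⟩ := Nat.exists_eq_add_of_le h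
      exact ⟨(g.natDegree + 1) / 2, g.natDegree / 2, 0, min e ((g.natDegree + 1) / 2),
        e - min e ((g.natDegree + 1) / 2), by omega, by omega, by omega, by omega, by omega,
        by omega⟩
  set τ := LinearMap.trace F _ ((mulRoot ((X - C c) * g)).prodMap
    (c • (1 : Module.End F (Fin t → F)))) with hτ
  have htr : τ = LinearMap.trace F _ (mulRoot g) + (t + 1 : ℕ) * c := by
    have hm : 0 < ((X - C c) * g).natDegree := by
      rw [(monic_X_sub_C c).natDegree_mul hg, natDegree_X_sub_C]; omega
    rw [hτ, LinearMap.trace_prodMap', trace_mulRoot ((monic_X_sub_C c).mul hg) hm,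
      trace_mulRoot hg (by omega), (monic_X_sub_C c).nextCoeff_mul hg, nextCoeff_X_sub_C, map_smul,
      LinearMap.trace_one]
    simp
    ring
  refine ⟨{0, -c, τ, τ + c, τ / 2}, fun y hy => ?_⟩
  simp only [Finset.mem_insert, Finset.mem_singleton, not_or] at hy
  obtain ⟨hy0, hyc, hyτ, hyτc, hyτ2⟩ := hy
  set z := y - τ with hz
  let i₀ : Fin a := ⟨0, by omega⟩
  obtain ⟨R, hR, S, f, hS, hs, hχ, hann⟩ := exists_sub_sim_lowerBlock_of_trace hg hk hb hab ha' hb'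
    c y z (by rw [hsum]; linear_combination hz - htr) i₀ rfl
  obtain ⟨W, _, _, _, G, U, _, _, K, hK, hWr, hG, hsf⟩ := exists_sim_of_charpoly hy0
    (sub_ne_zero.2 hyτ) hc (fun h => hyτ2 (by
      rw [eq_div_iff (NeZero.ne (2 : F))]
      linear_combination h - hz)) hyc (fun h => hyτc (by linear_combination h - hz)) hχ hann
  let φ : (Fin a ⊕ Fin b → F) →ₗ[F] F := LinearMap.proj (.inl i₀)
  have hφ : φ (Pi.single (.inl i₀) 1) = 1 := by simp [φ]
  have hker : Module.finrank F (LinearMap.ker φ) + 1 = a + b := by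
    have h := φ.finrank_range_add_finrank_ker
    rw [LinearMap.range_eq_top.2 fun x => ⟨x • Pi.single (.inl i₀) 1, by
      rw [map_smul, hφ, smul_eq_mul, mul_one]⟩, finrank_top, Module.finrank_self] at h
    simp at h
    omega
  have h₁ : Sim ((mulRoot ((X - C c) * g)).prodMap (c • (1 : Module.End F (Fin t → F))))
      ((lowerBlock (c • 1) R (mulRoot g)).prodMap (c • (1 : Module.End F (Fin (a' + b') → F)))) :=
    (sim_lowerBlock_mulRoot hg (by omega) c R φ _ hR hφ).prod_smul_one (by
      rw [Module.finrank_fin_fun, Module.finrank_fin_fun]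
      omega)
  obtain ⟨S', hS', hs'⟩ := h₁.trans_modSquareZero (SimModSquareZero.prod ⟨S, hS, hs.trans hsf⟩
    (simModSquareZero_smul_one_neg (V := Fin (a' + b') → F) hG (by
      rw [hWr, Module.finrank_fin_fun])))
  exact ⟨S', hS', hasEnds_of_sim_prod_neg hK hs'⟩

end Modulo

/-! ### Absorption by several summands, and chains with one end -/

section Lists

variable {F : Type u} [Field F]
variable {V W U : Type u} [AddCommGroup V] [Module F V] [AddCommGroup W] [Module F W]
  [AddCommGroup U] [Module F U]

theorem HasCyclicType.sim_smul_one {c : F} {t : ℕ} :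
    ∀ {V : Type u} [AddCommGroup V] [Module F V] {f : Module.End F V},
      HasCyclicType (List.replicate t (X - C c)) f →
        Sim f (c • (1 : Module.End F (Fin t → F))) := by
  induction t with
  | zero =>
    intro V _ _ f h
    have : Subsingleton V := h
    exact Sim.of_subsingleton _ _
  | succ t ih =>
    rintro V _ _ f ⟨W, _, _, g, hg, hs⟩
    refine hs.trans (((sim_mulRoot_X_sub_C c).prod (ih hg)).trans ?_)
    rw [smul_one_prodMap]
    exact Sim.smul_one c (by simp [add_comm])

/-- The number of one-dimensional summands `c` that the construction can attach to a cyclic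
endomorphism whose polynomial has degree `d` and is divisible by `X - c`. In degree two none can be
attached, although `2 * d - 3 = 1`. -/
def absorptionBound (d : ℕ) : ℕ := if d = 2 then 0 else 2 * d - 3

theorem linkable_mulRoot_prod_smul_one [NeZero (2 : F)] {p : F[X]} (hp : p.Monic)
    (h2 : 2 ≤ p.natDegree) {c : F} {t : ℕ} (hc : t ≠ 0 → c ≠ 0 ∧ X - C c ∣ p)
    (ht : t ≤ absorptionBound p.natDegree) :
    Linkable ((mulRoot p).prodMap (c • (1 : Module.End F (Fin t → F)))) := by
  rcases eq_or_ne t 0 with rfl | h0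
  · exact (linkable_mulRoot hp h2).of_sim (Sim.prod_subsingleton _ _)
  · obtain ⟨hc0, q, rfl⟩ := hc h0
    have hq : q.Monic := (monic_X_sub_C c).of_mul_monic_left hp
    rw [(monic_X_sub_C c).natDegree_mul hq, natDegree_X_sub_C] at h2 ht
    unfold absorptionBound at ht
    split_ifs at ht with h
    · omega
    · exact linkable_mulRoot_prod hq hc0 (by omega) (by omega) (by omega)

theorem HasCyclicType.linkable_prod_smul_one [NeZero (2 : F)] {c : F} {L : List F[X]}
    (hL : ∀ p ∈ L, p.Monic ∧ 2 ≤ p.natDegree) (hne : L ≠ []) :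
    ∀ {t : ℕ} {V : Type u} [AddCommGroup V] [Module F V] {f : Module.End F V},
      (t ≠ 0 → c ≠ 0 ∧ ∀ p ∈ L, X - C c ∣ p) →
      t ≤ (L.map fun p => absorptionBound p.natDegree).sum → HasCyclicType L f →
        Linkable (f.prodMap (c • (1 : Module.End F (Fin t → F)))) := by
  induction L with
  | nil => exact absurd rfl hne
  | cons p L ih =>
    rintro t V _ _ f hc ht ⟨W, _, _, g, hg, hs⟩
    obtain ⟨hp, h2⟩ := hL p List.mem_cons_self
    have hL' : ∀ q ∈ L, q.Monic ∧ 2 ≤ q.natDegree := fun q hq => hL q (List.mem_cons_of_mem p hq)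
    have := finiteDimensional_adjoinRoot hp
    have := (hg.finiteDimensional fun q hq => (hL' q hq).1).1
    rw [List.map_cons, List.sum_cons] at ht
    rcases eq_or_ne L [] with rfl | hne'
    · have : Subsingleton W := hg
      refine (linkable_mulRoot_prod_smul_one hp h2 (fun h => ⟨(hc h).1, (hc h).2 p (by simp)⟩)
        (by simpa using ht)).of_sim ((hs.trans (Sim.prod_subsingleton _ _)).prod (Sim.refl _))
    · obtain ⟨t₁, t₂, rfl, h₁, h₂⟩ : ∃ t₁ t₂, t = t₁ + t₂ ∧ t₁ ≤ absorptionBound p.natDegree ∧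
          t₂ ≤ (L.map fun p => absorptionBound p.natDegree).sum :=
        ⟨min t (absorptionBound p.natDegree), t - min t (absorptionBound p.natDegree), by omega,
          by omega, by omega⟩
      have hB := linkable_mulRoot_prod_smul_one (c := c) (t := t₁) hp h2
        (fun h => ⟨(hc (by omega)).1, (hc (by omega)).2 p (by simp)⟩) h₁
      have hC := ih hL' hne' (t := t₂) (f := g)
        (fun h => ⟨(hc (by omega)).1, fun q hq => (hc (by omega)).2 q (List.mem_cons_of_mem p hq)⟩)
        h₂ hg
      have hsum : Sim (c • (1 : Module.End F (Fin (t₁ + t₂) → F)))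
          ((c • (1 : Module.End F (Fin t₁ → F))).prodMap
            (c • (1 : Module.End F (Fin t₂ → F)))) := by
        rw [smul_one_prodMap]
        exact Sim.smul_one c (by simp)
      exact (hB.prod hC).of_sim ((hs.prod hsum).trans (Sim.prodProdProdComm _ _ _ _))

theorem HasCyclicType.oddModSquareZero [NeZero (2 : F)] [Infinite F] {L : List F[X]}
    (hL : ∀ p ∈ L, p.Monic ∧ 2 ≤ p.natDegree) {f : Module.End F V} (hf : HasCyclicType L f)
    (htr : LinearMap.trace F V f = 0) : OddModSquareZero f := by
  rcases eq_or_ne L [] with rfl | hne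
  · have : Subsingleton V := hf
    exact ⟨0, mul_zero 0, OddEnd.of_subsingleton _⟩
  · refine Linkable.oddModSquareZero ?_ htr
    exact (hf.linkable_prod_smul_one (c := 0) (t := 0) hL hne (fun h => absurd rfl h)
      (Nat.zero_le _)).of_sim (Sim.prod_subsingleton _ _).symm

end Lists

section HalfChain

variable {F : Type u} [Field F]
variable {V W U U' : Type u} [AddCommGroup V] [Module F V] [AddCommGroup W] [Module F W]
  [AddCommGroup U] [Module F U] [AddCommGroup U'] [Module F U']

/-- After subtraction of a square-zero endomorphism, `B` becomes the direct sum of `Y` and of an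
odd endomorphism. -/
def HasEnd (B : Module.End F V) (Y : Module.End F U) : Prop :=
  ∃ (W : Type u) (_ : AddCommGroup W) (_ : Module F W) (K : Module.End F W), OddEnd K ∧
    SimModSquareZero B (Y.prodMap K)

theorem HasEnd.of_sim {B : Module.End F V} {C : Module.End F W} {Y : Module.End F U}
    (h : Sim B C) (hC : HasEnd C Y) : HasEnd B Y := by
  obtain ⟨W, _, _, K, hK, hs⟩ := hC
  exact ⟨W, _, _, K, hK, h.trans_modSquareZero hs⟩

theorem SimModSquareZero.hasEnd {B : Module.End F V} {Y : Module.End F U}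
    (h : SimModSquareZero B Y) : HasEnd B Y :=
  ⟨PUnit.{u + 1}, inferInstance, inferInstance, 0, OddEnd.zero,
    h.trans_sim (Sim.prod_subsingleton _ _).symm⟩

theorem HasEnd.oddModSquareZero_prod {B : Module.End F V} {C : Module.End F W}
    {Y : Module.End F U} (hB : HasEnd B Y) (hC : SimModSquareZero C (-Y)) :
    OddModSquareZero (B.prodMap C) := by
  obtain ⟨W, _, _, K, hK, hs⟩ := hB
  refine (hs.prod hC).oddModSquareZero (((OddEnd.prod_neg Y).prod hK).of_sim ?_)
  exact (Sim.prodAssoc _ _ _).trans (((Sim.refl _).prod (Sim.prodComm _ _)).trans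
    (Sim.prodAssoc _ _ _).symm)

theorem HasEnd.oddModSquareZero {B : Module.End F V} (hB : HasEnd B (0 : Module.End F U)) :
    OddModSquareZero B := by
  obtain ⟨W, _, _, K, hK, hs⟩ := hB
  exact hs.oddModSquareZero (OddEnd.zero.prod hK)

theorem sim_lowerBlock_one (c μ : F) (e : U ≃ₗ[F] U') :
    Sim (lowerBlock (c • 1) (1 : Module.End F U) (μ • 1))
      (lowerBlock (c • 1) (1 : Module.End F U') (μ • 1)) :=
  ⟨LinearEquiv.prodCongr e e, fun v => by simp [lowerBlock_apply]⟩

theorem sim_lowerBlock_one_prod (c μ : F) :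
    Sim ((lowerBlock (c • 1) (1 : Module.End F U) (μ • 1)).prodMap
        (lowerBlock (c • 1) (1 : Module.End F U') (μ • 1)))
      (lowerBlock (c • 1) (1 : Module.End F (U × U')) (μ • 1)) :=
  ⟨LinearEquiv.prodProdProdComm F U U U' U', fun v => by simp [lowerBlock_apply]⟩

theorem sim_mulRoot_lowerBlock_one (c μ : F) :
    Sim (mulRoot ((X - C c) * (X - C μ))) (lowerBlock (c • 1) (1 : Module.End F F) (μ • 1)) := by
  have := finiteDimensional_adjoinRoot (monic_X_sub_C μ)
  have hr : Module.finrank F (AdjoinRoot (X - C μ)) = 1 := by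
    rw [finrank_adjoinRoot, natDegree_X_sub_C]
  have hμ : mulRoot (X - C μ) = μ • 1 := by
    obtain ⟨e, he⟩ := sim_mulRoot_X_sub_C μ
    ext v
    exact e.injective (by rw [he]; simp)
  let e : AdjoinRoot (X - C μ) ≃ₗ[F] F := LinearEquiv.ofFinrankEq _ _ (by simp [hr])
  have hnt := AdjoinRoot.nontrivial (X - C μ) (by simp)
  have he : e 1 ≠ 0 := fun h => one_ne_zero (e.map_eq_zero_iff.1 h)
  let φ : AdjoinRoot (X - C μ) →ₗ[F] F := (e 1)⁻¹ • e.toLinearMap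
  have hs := sim_lowerBlock_mulRoot (monic_X_sub_C μ) (by simp) c
    (1 : AdjoinRoot (X - C μ) →ₗ[F] AdjoinRoot (X - C μ)) φ 1 rfl (inv_mul_cancel₀ he)
  have hker : Subsingleton (LinearMap.ker φ) := by
    rw [Submodule.subsingleton_iff_eq_bot, LinearMap.ker_eq_bot']
    intro v hv
    have : (e 1)⁻¹ * e v = 0 := hv
    exact e.map_eq_zero_iff.1 ((mul_eq_zero.1 this).resolve_left (inv_ne_zero he))
  rw [hμ] at hs
  exact (Sim.prod_subsingleton _ _).symm.trans (hs.symm.trans (sim_lowerBlock_one c μ e))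

/-- A direct sum of `d` copies of the companion endomorphism of `(X - c) (X - μ)` is a block
triangular endomorphism of the square of any `d`-dimensional space. -/
theorem HasCyclicType.sim_lowerBlock_one {c μ : F} {d : ℕ} :
    ∀ {V U : Type u} [AddCommGroup V] [Module F V] {f : Module.End F V} [AddCommGroup U]
      [Module F U] [FiniteDimensional F U], Module.finrank F U = d →
      HasCyclicType (List.replicate d ((X - C c) * (X - C μ))) f →
        Sim f (lowerBlock (c • 1) (1 : Module.End F U) (μ • 1)) := by
  induction d with
  | zero =>
    intro V U _ _ f _ _ _ hU h
    have : Subsingleton V := h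
    have : Subsingleton U := Module.finrank_zero_iff.1 hU
    exact Sim.of_subsingleton _ _
  | succ d ih =>
    rintro V U _ _ f _ _ _ hU ⟨W, _, _, g, hg, hs⟩
    refine hs.trans (((sim_mulRoot_lowerBlock_one c μ).prod
      (ih (U := Fin d → F) (by simp) hg)).trans ?_)
    exact (sim_lowerBlock_one_prod c μ).trans (SquareZeroSum.sim_lowerBlock_one c μ
      (LinearEquiv.ofFinrankEq _ _ (by simp [hU, add_comm])))

/-- Subtracting a square-zero endomorphism turns the diagonal blocks `c`, `μ` into `-Y` and
`Y + c + μ`, and these split off if they have no common eigenvalue. -/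
theorem simModSquareZero_lowerBlock_one {c μ : F} {Y : Module.End F U}
    (h : IsUnit (2 * Y + (c + μ) • 1)) :
    SimModSquareZero (lowerBlock (c • 1) (1 : Module.End F U) (μ • 1))
      ((-Y).prodMap (Y + (c + μ) • 1)) := by
  obtain ⟨S, hS, hs⟩ := exists_sub_sim_lowerBlock (c • 1) (1 : Module.End F U) (μ • 1)
    (-Y - c • 1)
  refine ⟨S, hS, hs.trans ?_⟩
  have h1 : c • 1 + (-Y - c • 1) ∘ₗ (1 : Module.End F U) = -Y := by
    ext v; simp
  have h2 : μ • 1 - (1 : Module.End F U) ∘ₗ (-Y - c • 1) = Y + (c + μ) • 1 := by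
    ext v; simp [add_smul]; abel
  rw [h1, h2]
  obtain ⟨u, hu⟩ := h
  have hcomm : Commute Y (↑u⁻¹ : Module.End F U) := by
    apply Commute.units_inv_right
    rw [hu]
    exact (((Commute.ofNat_right Y 2).mul_right (Commute.refl Y))).add_right
      ((Commute.one_right Y).smul_right _)
  set T : Module.End F U := ↑u⁻¹ with hT
  have hinv : ∀ w, Y (T w) + Y (T w) + (c + μ) • T w = w := fun w => by
    have := LinearMap.congr_fun (u.mul_inv) w
    rw [hu] at this
    simpa [two_mul] using this
  have hc : ∀ w, Y (T w) = T (Y w) := fun w => LinearMap.congr_fun hcomm w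
  let e : (U × U) ≃ₗ[F] (U × U) :=
    { ((LinearMap.fst F U U).prod (LinearMap.snd F U U + T ∘ₗ LinearMap.fst F U U) :
        U × U →ₗ[F] U × U) with
      invFun := fun v => (v.1, v.2 - T v.1)
      left_inv := fun v => Prod.ext rfl (add_sub_cancel_right _ _)
      right_inv := fun v => Prod.ext rfl (sub_add_cancel _ _) }
  have he : ∀ v, e v = (v.1, v.2 + T v.1) := fun v => rfl
  refine ⟨e, fun v => ?_⟩
  rw [he, he, lowerBlock_apply]
  refine Prod.ext rfl ?_
  simp only [LinearMap.prodMap_apply, LinearMap.add_apply, LinearMap.smul_apply,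
    Module.End.one_apply, LinearMap.neg_apply, map_neg, map_add]
  nth_rewrite 1 [← hinv v.1]
  rw [hc]
  abel

/-- One step of a chain: the end `Y` is cancelled against `-Y` and becomes `Y + c + μ`. -/
theorem HasEnd.prod_lowerBlock_one {B : Module.End F V} {Y : Module.End F U} {c μ : F}
    (hB : HasEnd B Y) (h : IsUnit (2 * Y + (c + μ) • 1)) :
    HasEnd (B.prodMap (lowerBlock (c • 1) (1 : Module.End F U) (μ • 1))) (Y + (c + μ) • 1) := by
  obtain ⟨W, _, _, K, hK, hs⟩ := hB
  refine ⟨_, _, _, _, (OddEnd.prod_neg Y).prod hK,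
    (hs.prod (simModSquareZero_lowerBlock_one h)).trans_sim ?_⟩
  refine (Sim.prodProdProdComm _ _ _ _).trans ?_
  refine ((Sim.refl _).prod (Sim.prodComm _ _)).trans ?_
  exact (Sim.prodLeftComm _ _ _)

/-- A chain of `k` steps, each of which uses `finrank F U` cyclic summands. -/
theorem HasEnd.prod_of_hasCyclicType [FiniteDimensional F U] {c μ : F} {k : ℕ} :
    ∀ {V W : Type u} [AddCommGroup V] [Module F V] [AddCommGroup W] [Module F W]
      {B : Module.End F V} {g : Module.End F W} {Y : Module.End F U}, HasEnd B Y →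
      (∀ j < k, IsUnit (2 * Y + ((2 * j + 1 : ℕ) * (c + μ)) • 1)) →
      HasCyclicType (List.replicate (Module.finrank F U * k) ((X - C c) * (X - C μ))) g →
      HasEnd (B.prodMap g) (Y + (k * (c + μ)) • 1) := by
  induction k with
  | zero =>
    intro V W _ _ _ _ B g Y hB _ hg
    have : Subsingleton W := hg
    simpa using hB.of_sim (Sim.prod_subsingleton B g)
  | succ k ih =>
    intro V W _ _ _ _ B g Y hB hY hg
    rw [mul_add, mul_one, add_comm, ← List.replicate_append_replicate] at hg
    obtain ⟨W₁, _, _, g₁, W₂, _, _, g₂, h₁, h₂, hs⟩ := hg.append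
    have hB' := hB.prod_lowerBlock_one (c := c) (μ := μ) (by simpa using hY 0 (by omega))
    have := ih hB' (fun j hj => by
      have h : 2 * (Y + (c + μ) • 1) + ((2 * j + 1 : ℕ) * (c + μ)) • 1 =
          2 * Y + ((2 * (j + 1) + 1 : ℕ) * (c + μ)) • 1 := by
        rw [two_mul Y, two_mul (Y + (c + μ) • 1)]
        push_cast
        module
      rw [h]
      exact hY (j + 1) (by omega)) h₂
    have h : Y + (c + μ) • 1 + (k * (c + μ)) • 1 = Y + ((k + 1 : ℕ) * (c + μ)) • 1 := by
      push_cast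
      module
    rw [h] at this
    have h₃ := hs.trans ((h₁.sim_lowerBlock_one (U := U) rfl).prod (Sim.refl g₂))
    exact this.of_sim (((Sim.refl B).prod h₃).trans (Sim.prodAssoc _ _ _).symm)

end HalfChain

/-! ### Equal summands of degree two, and nullities -/

section Exceptional

variable {F : Type u} [Field F]
variable {V W U : Type u} [AddCommGroup V] [Module F V] [AddCommGroup W] [Module F W]
  [AddCommGroup U] [Module F U]

theorem isUnit_add_smul_one {N : Module.End F U} (hN : N * N = 0) {a : F} (ha : a ≠ 0) :
    IsUnit (N + a • 1) := by
  refine ⟨⟨N + a • 1, a⁻¹ • 1 - (a⁻¹ * a⁻¹) • N, ?_, ?_⟩, rfl⟩ <;>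
  · simp only [mul_sub, add_mul, sub_mul, mul_add, mul_smul_comm, smul_mul_assoc, hN, mul_one,
      one_mul, smul_zero]
    match_scalars <;> field_simp
    ring

theorem HasCyclicType.trace_of_replicate {q : F[X]} (hq : q.Monic) (h0 : 0 < q.natDegree)
    {m : ℕ} : ∀ {V : Type u} [AddCommGroup V] [Module F V] {f : Module.End F V},
      HasCyclicType (List.replicate m q) f → LinearMap.trace F V f = -(m * q.nextCoeff) := by
  induction m with
  | zero =>
    intro V _ _ f h
    have : Subsingleton V := h
    rw [Subsingleton.elim f 0]
    simp
  | succ m ih =>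
    rintro V _ _ f ⟨W, _, _, g, hg, hs⟩
    have := finiteDimensional_adjoinRoot hq
    have : FiniteDimensional F W := (HasCyclicType.finiteDimensional hg fun p hp => by
      rw [List.eq_of_mem_replicate hp]; exact hq).1
    rw [hs.trace_eq, LinearMap.trace_prodMap', trace_mulRoot hq h0, ih hg]
    push_cast
    ring

/-- The case in which at most two one-dimensional summands `c` have to be matched with cyclic
summands that all have the same polynomial of degree two. A chain whose end has the dimension of the
scalar part is run through these summands; its steps are possible because an odd, respectively
positive, integer multiple of `c + μ` is nonzero in characteristic zero. -/
theorem HasCyclicType.oddModSquareZero_smul_one_prod [CharZero F] {c μ : F} (hc : c ≠ 0)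
    {t m : ℕ} (ht : t = 1 ∨ t = 2) {g : Module.End F W}
    (hg : HasCyclicType (List.replicate m ((X - C c) * (X - C μ))) g)
    (htr : t * c + m * (c + μ) = 0) :
    OddModSquareZero ((c • (1 : Module.End F (Fin t → F))).prodMap g) := by
  have hs0 : c + μ ≠ 0 := by
    intro h
    rw [h, mul_zero, add_zero] at htr
    rcases mul_eq_zero.1 htr with h | h
    · rcases ht with rfl | rfl <;> norm_num at h
    · exact hc h
  by_cases hm : t ∣ m
  · -- the chain starts at `c` and ends at `0`
    obtain ⟨k, rfl⟩ := hm
    have hck : c + k * (c + μ) = 0 := by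
      have ht0 : (t : F) ≠ 0 := by rcases ht with rfl | rfl <;> norm_num
      refine (mul_eq_zero.1 ?_).resolve_left ht0
      push_cast at htr
      linear_combination htr
    have hend : HasEnd (c • (1 : Module.End F (Fin t → F))) (c • (1 : Module.End F (Fin t → F))) :=
      (Sim.refl _).modSquareZero.hasEnd
    have h := hend.prod_of_hasCyclicType (c := c) (μ := μ) (k := k) (g := g) (fun j _ => by
      have hj : (2 * c + (2 * j + 1 : ℕ) * (c + μ)) ≠ 0 := by
        have h1 : 2 * c + (2 * j + 1 : ℕ) * (c + μ) =
            ((2 * j + 1 - 2 * k : ℤ) : F) * (c + μ) := by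
          push_cast
          linear_combination 2 * hck
        rw [h1]
        refine mul_ne_zero (Int.cast_ne_zero.2 ?_) hs0
        omega
      convert isUnit_add_smul_one (U := Fin t → F) (mul_zero 0) hj using 1
      rw [zero_add, two_mul]
      module) (by rwa [Module.finrank_fin_fun])
    rw [← add_smul, hck, zero_smul] at h
    exact h.oddModSquareZero
  · -- the chain starts at `(c + μ) / 2 + ν` and ends at `-c + ν`, where `ν ^ 2 = 0`
    obtain rfl : t = 2 := ht.resolve_left (by rintro rfl; exact hm (one_dvd m))
    obtain ⟨k, rfl⟩ : ∃ k, m = 2 * k + 1 := ⟨m / 2, by omega⟩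
    set h := (c + μ) / 2 with hh
    have h2 : 2 * h = c + μ := by rw [hh]; ring
    have hmon : ((X - C h) ^ 2 : F[X]).Monic := (monic_X_sub_C h).pow 2
    have hdeg : ((X - C h) ^ 2 : F[X]).natDegree = 2 := by
      rw [(monic_X_sub_C h).natDegree_pow, natDegree_X_sub_C]
    have := finiteDimensional_adjoinRoot hmon
    have hrank : Module.finrank F (AdjoinRoot ((X - C h) ^ 2 : F[X])) = 2 := by
      rw [finrank_adjoinRoot, hdeg]
    set ν : Module.End F (AdjoinRoot ((X - C h) ^ 2 : F[X])) :=
      mulRoot ((X - C h) ^ 2) - h • 1 with hν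
    have hν2 : ν * ν = 0 := by
      ext v
      obtain ⟨a, rfl⟩ := AdjoinRoot.mk_surjective v
      have : ∀ a, ν (AdjoinRoot.mk _ a) = AdjoinRoot.mk _ ((X - C h) * a) := fun a => by
        rw [hν, LinearMap.sub_apply, mulRoot_mk, LinearMap.smul_apply, Module.End.one_apply,
          AdjoinRoot.smul_mk, ← map_sub, sub_mul, smul_eq_C_mul]
      rw [Module.End.mul_apply, this, this, ← mul_assoc, ← pow_two, map_mul, AdjoinRoot.mk_self,
        zero_mul]
      rfl
    have hY : mulRoot ((X - C h) ^ 2) = ν + h • 1 := by rw [hν, sub_add_cancel]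
    rw [List.replicate_succ] at hg
    obtain ⟨W', _, _, g', hg', hs⟩ := hg
    obtain ⟨S, hS, hsim⟩ := exists_sub_sim_mulRoot
      (p := (X - C c) * (X - C μ)) ((monic_X_sub_C c).mul (monic_X_sub_C μ)) hmon
      (by rw [(monic_X_sub_C c).natDegree_mul (monic_X_sub_C μ), hdeg]; simp)
      (by rw [(monic_X_sub_C c).natDegree_mul (monic_X_sub_C μ)]; simp)
      (by
        rw [(monic_X_sub_C c).nextCoeff_mul (monic_X_sub_C μ), pow_two,
          (monic_X_sub_C h).nextCoeff_mul (monic_X_sub_C h)]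
        simp only [nextCoeff_X_sub_C]
        linear_combination h2)
    have hend : HasEnd (mulRoot ((X - C c) * (X - C μ))) (ν + h • 1) := by
      rw [← hY]
      exact SimModSquareZero.hasEnd ⟨S, hS, hsim⟩
    have hk := hend.prod_of_hasCyclicType (c := c) (μ := μ) (k := k) (g := g') (fun j _ => by
      have hj : (2 * j + 2 : F) * (c + μ) ≠ 0 := by
        refine mul_ne_zero ?_ hs0
        exact_mod_cast (by omega : 2 * j + 2 ≠ 0)
      have hnn : (ν + ν) * (ν + ν) = 0 := by simp [mul_add, add_mul, hν2]
      convert isUnit_add_smul_one hnn hj using 1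
      rw [two_mul, ← h2]
      push_cast
      module) (by rwa [hrank])
    refine OddModSquareZero.of_sim ((Sim.prodComm _ _).trans (hs.prod (Sim.refl _))) ?_
    refine hk.oddModSquareZero_prod (simModSquareZero_smul_one_neg ?_ (by
      rw [hrank, Module.finrank_fin_fun]))
    have hz : h + k * (c + μ) + c = 0 := by
      push_cast at htr
      linear_combination htr / 2 + hh
    have : ν + h • 1 + (k * (c + μ)) • 1 + c • 1 = ν := by
      have : ν + h • 1 + (k * (c + μ)) • 1 + c • 1 = ν + (h + k * (c + μ) + c) • 1 := by module
      rw [this, hz, zero_smul, add_zero]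
    rw [this]
    exact (pow_two ν).trans hν2

end Exceptional

section Nullity

variable {F : Type u} [Field F]
variable {V W U : Type u} [AddCommGroup V] [Module F V] [AddCommGroup W] [Module F W]
  [AddCommGroup U] [Module F U]

theorem Sim.finrank_ker_sub {f : Module.End F V} {g : Module.End F W} (h : Sim f g) (c : F) :
    Module.finrank F (LinearMap.ker (f - c • 1)) =
      Module.finrank F (LinearMap.ker (g - c • 1)) := by
  obtain ⟨e, he⟩ := h
  refine LinearEquiv.finrank_eq (e.ofSubmodules _ _ ?_)
  ext w
  rw [Submodule.mem_map_equiv, LinearMap.mem_ker, LinearMap.mem_ker, ← e.map_eq_zero_iff]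
  simp [he]

theorem finrank_ker_prodMap [FiniteDimensional F V] [FiniteDimensional F W] (f : Module.End F V)
    (g : Module.End F W) : Module.finrank F (LinearMap.ker (f.prodMap g)) =
      Module.finrank F (LinearMap.ker f) + Module.finrank F (LinearMap.ker g) := by
  rw [LinearMap.ker_prodMap, ← Module.finrank_prod]
  exact LinearEquiv.finrank_eq
    { toFun := fun v => (⟨v.1.1, v.2.1⟩, ⟨v.1.2, v.2.2⟩)
      invFun := fun v => ⟨(v.1, v.2), v.1.2, v.2.2⟩
      map_add' := fun _ _ => rfl
      map_smul' := fun _ _ => rfl }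

/-- Each cyclic summand whose polynomial is divisible by `X - c` contributes an eigenvector. -/
theorem HasCyclicType.length_le_finrank_ker {c : F} {L : List F[X]}
    (hL : ∀ p ∈ L, p.Monic ∧ X - C c ∣ p) :
    ∀ {V : Type u} [AddCommGroup V] [Module F V] {f : Module.End F V}, HasCyclicType L f →
      L.length ≤ Module.finrank F (LinearMap.ker (f - c • 1)) := by
  induction L with
  | nil => intros; exact Nat.zero_le _
  | cons p L ih =>
    rintro V _ _ f ⟨W, _, _, g, hg, hs⟩
    have hL' : ∀ q ∈ L, q.Monic ∧ X - C c ∣ q := fun q hq => hL q (List.mem_cons_of_mem p hq)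
    obtain ⟨hp, q, rfl⟩ := hL p List.mem_cons_self
    have := finiteDimensional_adjoinRoot hp
    have := (hg.finiteDimensional fun q hq => (hL' q hq).1).1
    have hsub : (mulRoot ((X - C c) * q)).prodMap g - c • 1 =
        (mulRoot ((X - C c) * q) - c • 1).prodMap (g - c • 1) := by
      rw [← LinearMap.prodMap_one]
      ext <;> simp
    rw [hs.finrank_ker_sub, hsub, finrank_ker_prodMap, List.length_cons, add_comm]
    refine Nat.add_le_add ?_ (ih hL' hg)
    have hq : q.Monic := (monic_X_sub_C c).of_mul_monic_left hp
    rw [Nat.one_le_iff_ne_zero, Ne, Submodule.finrank_eq_zero]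
    intro h0
    have hmem : AdjoinRoot.mk ((X - C c) * q) q ∈
        LinearMap.ker (mulRoot ((X - C c) * q) - c • 1) := by
      rw [LinearMap.mem_ker, LinearMap.sub_apply, mulRoot_mk, LinearMap.smul_apply,
        Module.End.one_apply, AdjoinRoot.smul_mk, ← map_sub, smul_eq_C_mul, ← sub_mul,
        AdjoinRoot.mk_self]
    rw [h0, Submodule.mem_bot, AdjoinRoot.mk_eq_zero] at hmem
    have := natDegree_le_of_dvd hmem hq.ne_zero
    rw [(monic_X_sub_C c).natDegree_mul hq, natDegree_X_sub_C] at this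
    omega

end Nullity

/-! ### Conclusion -/

section Core

variable {F : Type u} [Field F]
variable {V W U : Type u} [AddCommGroup V] [Module F V] [AddCommGroup W] [Module F W]
  [AddCommGroup U] [Module F U]

/-- In a reduced list with a member `X - c` of degree one, all members of degree one are equal to
`X - c`, and all members are divisible by `X - c`. -/
theorem ReducedList.exists_perm {L : List F[X]} (hL : ReducedList L) {p : F[X]} (hp : p ∈ L)
    (h1 : p.natDegree = 1) :
    ∃ (c : F) (t : ℕ) (L' : List F[X]), 1 ≤ t ∧ L.Perm (List.replicate t (X - C c) ++ L') ∧
      (∀ q ∈ L', (q.Monic ∧ 2 ≤ q.natDegree) ∧ X - C c ∣ q) ∧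
      L'.Pairwise fun q r => q.natDegree = 2 → r.natDegree = 2 → q = r := by
  obtain ⟨hmon, hpair⟩ := hL
  obtain ⟨c, rfl⟩ : ∃ c, p = X - C c := ⟨-p.coeff 0, by
    rw [map_neg, sub_neg_eq_add]
    exact (hmon p hp).1.eq_X_add_C h1⟩
  have hdvd : ∀ q ∈ L, X - C c ∣ q := by
    intro q hq
    rcases eq_or_ne (X - C c) q with rfl | hne
    · exact dvd_rfl
    have : Std.Symm fun p q : F[X] => ¬ IsCoprime p q :=
      ⟨fun _ _ h h' => h h'.symm⟩
    have h := (hpair.imp fun h => h.1 : L.Pairwise fun p q => ¬ IsCoprime p q).forall hp hq hne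
    exact (dvd_or_isCoprime _ q (irreducible_X_sub_C c)).resolve_right h
  have hone : ∀ q ∈ L, q.natDegree = 1 → q = X - C c := fun q hq h =>
    (eq_of_monic_of_dvd_of_natDegree_le (monic_X_sub_C c) (hmon q hq).1 (hdvd q hq)
      (by rw [h, natDegree_X_sub_C]))
  have hrep : L.filter (fun q => q.natDegree = 1) =
      List.replicate (L.filter fun q => q.natDegree = 1).length (X - C c) :=
    List.eq_replicate_of_mem fun q hq => by
      rw [List.mem_filter] at hq
      exact hone q hq.1 (by simpa using hq.2)
  refine ⟨c, (L.filter fun q => q.natDegree = 1).length,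
    L.filter (fun q => ! decide (q.natDegree = 1)), ?_, ?_, fun q hq => ?_, ?_⟩
  · exact List.length_pos_of_mem (List.mem_filter.2 ⟨hp, by simp⟩)
  · rw [← hrep]
    exact (List.filter_append_perm _ L).symm
  · rw [List.mem_filter] at hq
    obtain ⟨h, h'⟩ := hmon q hq.1
    have h2 : q.natDegree ≠ 1 := by simpa using hq.2
    exact ⟨⟨h, by omega⟩, hdvd q hq.1⟩
  · exact (hpair.imp fun h => h.2).filter _

theorem sum_absorptionBound_add {L : List F[X]} (hL : ∀ p ∈ L, 2 ≤ p.natDegree) :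
    (L.map fun p => absorptionBound p.natDegree).sum + L.countP (fun p => p.natDegree = 2) +
      3 * L.length = 2 * (L.map natDegree).sum := by
  induction L with
  | nil => rfl
  | cons p L ih =>
    have h2 := hL p List.mem_cons_self
    have := ih fun q hq => hL q (List.mem_cons_of_mem p hq)
    simp only [List.map_cons, List.sum_cons, List.countP_cons, List.length_cons, absorptionBound,
      decide_eq_true_eq] at this ⊢
    split_ifs <;> omega

/-- The total absorption bound is at least `∑ (deg p - 2)`, and larger by at least two if some
degree is not two. -/
theorem sum_natDegree_le {L : List F[X]} (hL : ∀ p ∈ L, 2 ≤ p.natDegree) :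
    (L.map natDegree).sum + (if ∀ p ∈ L, p.natDegree = 2 then 0 else 2) ≤
      (L.map fun p => absorptionBound p.natDegree).sum + 2 * L.length := by
  induction L with
  | nil => simp
  | cons p L ih =>
    have h2 := hL p List.mem_cons_self
    have := ih fun q hq => hL q (List.mem_cons_of_mem p hq)
    simp only [List.map_cons, List.sum_cons, List.length_cons, List.forall_mem_cons]
    unfold absorptionBound at this ⊢
    by_cases hp : p.natDegree = 2
    · simp only [hp, true_and, if_true]
      omega
    · simp only [hp, false_and, if_false]
      split_ifs at this <;> omega

/-- The criterion for endomorphisms. If the one-dimensional summands `c ≠ 0` cannot be absorbed by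
the other summands, then the bounds force all other summands to be equal and two-dimensional, and at
most two one-dimensional summands remain. -/
theorem HasCyclicType.oddModSquareZero_of_reducedList [CharZero F] {L : List F[X]}
    {f : Module.End F V} (hL : ReducedList L) (hf : HasCyclicType L f)
    (htr : LinearMap.trace F V f = 0)
    (hn : ∀ c : F, 3 * Module.finrank F (LinearMap.ker (f - c • 1)) +
        L.countP (fun p => p.natDegree = 2) ≤ 2 * Module.finrank F V ∨
      2 * Module.finrank F (LinearMap.ker (f - c • 1)) ≤ Module.finrank F V + 2) :
    OddModSquareZero f := by
  have hinf : Infinite F := CharZero.infinite F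
  by_cases h1 : ∃ p ∈ L, p.natDegree = 1
  swap
  · push Not at h1
    refine hf.oddModSquareZero (fun p hp => ⟨(hL.1 p hp).1, ?_⟩) htr
    have := (hL.1 p hp).2
    have := h1 p hp
    omega
  obtain ⟨p, hp, hp1⟩ := h1
  obtain ⟨c, t, L', ht, hperm, hL', hpair⟩ := hL.exists_perm hp hp1
  replace hf := hf.perm hperm
  have hmon : ∀ q ∈ List.replicate t (X - C c) ++ L', q.Monic := fun q hq =>
    (hL.1 q (hperm.mem_iff.2 hq)).1
  obtain ⟨hfd, hrank⟩ := hf.finiteDimensional hmon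
  obtain ⟨W₁, _, _, g₁, W, _, _, g, hg₁, hg, hs⟩ := hf.append
  obtain ⟨hfdW, hrW⟩ := hg.finiteDimensional fun q hq => (hL' q hq).1.1
  replace hs : Sim f ((c • (1 : Module.End F (Fin t → F))).prodMap g) :=
    hs.trans (hg₁.sim_smul_one.prod (Sim.refl g))
  have htr' : t * c + LinearMap.trace F W g = 0 := by
    rw [hs.trace_eq, LinearMap.trace_prodMap', map_smul, LinearMap.trace_one] at htr
    rw [← htr]
    simp [mul_comm]
  rcases eq_or_ne c 0 with rfl | hc
  · rw [mul_zero, zero_add] at htr'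
    rw [zero_smul] at hs
    refine OddModSquareZero.of_sim hs (OddModSquareZero.prod ⟨0, mul_zero 0, ?_⟩
      (hg.oddModSquareZero (fun q hq => (hL' q hq).1) htr'))
    rw [sub_zero]
    exact OddEnd.zero
  have hne : L' ≠ [] := by
    rintro rfl
    have : Subsingleton W := hg
    rw [Subsingleton.elim g 0, map_zero, add_zero] at htr'
    rcases mul_eq_zero.1 htr' with h | h
    · exact absurd (Nat.cast_eq_zero.1 h) (by omega)
    · exact hc h
  by_cases hbound : t ≤ (L'.map fun p => absorptionBound p.natDegree).sum
  · exact ((hg.linkable_prod_smul_one (fun q hq => (hL' q hq).1) hne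
      (fun _ => ⟨hc, fun q hq => (hL' q hq).2⟩) hbound).of_sim
        (hs.trans (Sim.prodComm _ _))).oddModSquareZero htr
  have hker : t + L'.length ≤ Module.finrank F (LinearMap.ker (f - c • 1)) := by
    have := hf.length_le_finrank_ker (c := c) fun q hq => ⟨hmon q hq, by
      rcases List.mem_append.1 hq with h | h
      · rw [List.eq_of_mem_replicate h]
      · exact (hL' q h).2⟩
    simpa using this
  have hcount : L.countP (fun p => p.natDegree = 2) = L'.countP (fun p => p.natDegree = 2) := by
    rw [hperm.countP_eq, List.countP_append, List.countP_replicate]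
    simp
  have hsum : Module.finrank F V = t + (L'.map natDegree).sum := by
    rw [hrank]
    simp
  have hb₁ := sum_absorptionBound_add fun q hq => (hL' q hq).1.2
  have hb₂ := sum_natDegree_le fun q hq => (hL' q hq).1.2
  have hn' := hn c
  rw [hcount] at hn'
  have hall : ∀ q ∈ L', q.natDegree = 2 := by
    by_contra h
    rw [if_neg h] at hb₂
    omega
  rw [if_pos hall] at hb₂
  have ht2 : t ≤ 2 := by
    have : (L'.map natDegree).sum = 2 * L'.length := by
      rw [List.map_congr_left hall]
      simp [mul_comm]
    omega
  obtain ⟨q, L'', rfl⟩ := List.exists_cons_of_ne_nil hne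
  obtain ⟨⟨hq, -⟩, hcq⟩ := hL' q List.mem_cons_self
  have hq2 := hall q List.mem_cons_self
  have hrep : q :: L'' = List.replicate (q :: L'').length q := by
    refine List.eq_replicate_of_mem fun r hr => ?_
    rcases List.mem_cons.1 hr with h | h
    · exact h
    · exact ((List.pairwise_cons.1 hpair).1 r h hq2 (hall r hr)).symm
  rw [hrep] at hg
  rw [hg.trace_of_replicate hq (by omega)] at htr'
  obtain ⟨μ, rfl⟩ := exists_eq_mul_X_sub_C hq hq2 hcq
  rw [(monic_X_sub_C c).nextCoeff_mul (monic_X_sub_C μ), nextCoeff_X_sub_C,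
    nextCoeff_X_sub_C] at htr'
  exact OddModSquareZero.of_sim hs (hg.oddModSquareZero_smul_one_prod hc (by omega)
    (by linear_combination htr'))

theorem finrank_ker_toLin'_sub {n : ℕ} (A : Matrix (Fin n) (Fin n) F) (c : F) :
    Module.finrank F (LinearMap.ker (Matrix.toLin' A - c • 1)) =
      nullity (A - c • (1 : Matrix (Fin n) (Fin n) F)) := by
  rw [nullity, map_sub, map_smul, Matrix.toLin'_one]
  rfl

/-- The first alternative of the hypothesis is the bound in terms of the number of invariant
polynomials of degree two, the second one is `n / 2 + 1`. -/
theorem isSumOfThreeSquareZero_of_nullity_le [CharZero F] {n : ℕ} {A : Matrix (Fin n) (Fin n) F}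
    (htr : A.trace = 0) {L : List F[X]} (hL : ReducedList L)
    (hA : HasCyclicType L (Matrix.toLin' A))
    (hn : ∀ c : F, 3 * nullity (A - c • (1 : Matrix (Fin n) (Fin n) F)) +
        L.countP (fun p => p.natDegree = 2) ≤ 2 * n ∨
      2 * nullity (A - c • (1 : Matrix (Fin n) (Fin n) F)) ≤ n + 2) :
    IsSumOfThreeSquareZero A := by
  refine isSumOfThreeSquareZero_of_toLin' (hA.oddModSquareZero_of_reducedList hL ?_ fun c => ?_)
  · rw [Matrix.trace_toLin'_eq, htr]
  · rw [finrank_ker_toLin'_sub, Module.finrank_fin_fun]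
    exact hn c

end Core

end SquareZeroSum

theorem mainTheorem12 {F : Type*} [Field F] [IsAlgClosed F] [CharZero F] {n : ℕ}
    (A : Matrix (Fin n) (Fin n) F) (htr : A.trace = 0) :
    -- the bound in terms of the number of invariant polynomials of degree two
    (∀ f : Fin n → Polynomial F, IsInvariantPolynomials A f →
      (∀ c : F, (nullity (A - c • (1 : Matrix (Fin n) (Fin n) F)) : ℚ)
        ≤ (2 * (n : ℚ) - (numDegreeTwo f : ℚ)) / 3) →
      IsSumOfThreeSquareZero A) ∧
    -- the bound `n / 2`
    ((∀ c : F, (nullity (A - c • (1 : Matrix (Fin n) (Fin n) F)) : ℚ) ≤ (n : ℚ) / 2) →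
      IsSumOfThreeSquareZero A) ∧
    -- the bound `n / 2 + 1`
    ((∀ c : F, (nullity (A - c • (1 : Matrix (Fin n) (Fin n) F)) : ℚ) ≤ (n : ℚ) / 2 + 1) →
      IsSumOfThreeSquareZero A) := by
  have h3 : (∀ c : F, (nullity (A - c • (1 : Matrix (Fin n) (Fin n) F)) : ℚ) ≤ (n : ℚ) / 2 + 1) →
      IsSumOfThreeSquareZero A := by
    intro h
    obtain ⟨L, hL, hA⟩ := SquareZeroSum.exists_reducedList (Matrix.toLin' A)
    refine SquareZeroSum.isSumOfThreeSquareZero_of_nullity_le htr hL hA fun c => Or.inr ?_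
    have := h c
    qify
    linarith
  refine ⟨fun f hf h => ?_, fun h => h3 fun c => (h c).trans (by linarith), h3⟩
  refine SquareZeroSum.isSumOfThreeSquareZero_of_nullity_le htr
    (SquareZeroSum.reducedList_filter_ofFn hf.1 hf.2.1)
    (SquareZeroSum.HasCyclicType.filter (fun p hp => ?_)
      (SquareZeroSum.hasCyclicType_of_isInvariantPolynomials hf)) fun c => Or.inl ?_
  · obtain ⟨i, rfl⟩ := (List.mem_ofFn' f p).1 hp
    exact hf.1 i
  · rw [SquareZeroSum.countP_filter_ofFn]
    have := h c
    qify
    linarith
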